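/- Let $N\ge 1$ and consider $N+1$ qubits $A_1,\dots,A_N,A_{N+1}$. For a set $a$ of qubits let $\vec S_a=\frac12\sum_{i\in a}(\sigma_x^{(i)},\sigma_y^{(i)},\sigma_z^{(i)})$, $S_a^2=\vec S_a\cdot\vec S_a$ and $Z_a=\frac12\sum_{i\in a}\sigma_z^{(i)}$; a state has spin $j$ on $a$ if it is an eigenvector of $S^2_a$ with eigenvalue $j(j+1)$. The Schur states $|k_1,\dots,k_{n-2},j,m\rangle$ of $n$ qubits are obtained by coupling the qubits one after the other with the Clebsch–Gordan coefficients ($|0\rangle$, $|1\rangle$ having $Z$-spin $\pm\frac12$) $$C^{j\pm\frac12,M}_{j,M-\frac12;\frac12,\frac12}=\pm\sqrt{\tfrac12\Bigl(1\pm\tfrac{M}{j+\frac12}\Bigr)},\qquad C^{j\pm\frac12,M}_{j,M+\frac12;\frac12,-\frac12}=\sqrt{\tfrac12\Bigl(1\mp\tfrac{M}{j+\frac12}\Bigr)};$$ here $k_r$ is the spin of the first $r+1$ qubits, $j$ the spin and $m\in\{-j,-j+1,\dots,j\}$ the $Z$-spin of all the qubits, successive spins differ by $\frac12$, one qubit has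 spin $\frac12$ and no qubits have spin $0$. For $N+1$ qubits write $|\tilde k,k_{N-2},j,s,m\rangle$, where $k_{N-2}$, $j$, $s$ are the spins of the first $N-1$, $N$, $N+1$ qubits and $\tilde k$ stands for the spins of the shorter initial segments. Let $|\psi^-\rangle=(|01\rangle-|10\rangle)/\sqrt2$, $\lambda^+_j=2^{-N}(\frac N2+j+1)$, and on $N-1$ qubits $\tilde\Theta=2^{-(N-1)}\sum_{s}\mathbb I(s)/\lambda^+_{s+1/2}$, where $s$ runs over $s_{\min},s_{\min}+1,\dots,\frac{N-1}2$ with $s_{\min}\in\{0,\frac12\}$, $s_{\min}\equiv\frac{N-1}2 \pmod 1$, and $\mathbb I(s)$ is the orthogonal projector onto the spin-$s$ subspace. The POVM of probabilistic port-based teleportation with maximally entangled resource state is $$\Pi_i=|\psi^-\rangle\langle\psi^-|_{A_iA_{N+1}}\otimes\tilde\Theta_{\bar A_i}\quad(1\le i\le N),\qquad \Pi_{N+1}=I-\sum_{i=1}^N\Pi_i,$$ where $\bar A_i$ denotes the ports $A_1,\dots,A_N$ other than $A_i$. Then: 1. The Schur states of the $N+1$ qubits form an orthonormal basis of simultaneous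 eigenvectors of $S^2_{\{1,\dots,r\}}$ ($0\le r\le N+1$) and $Z$, with the eigenvalues given by their labels. 2. For every Schur label $(\tilde k,s,m)$ of the first $N-1$ qubits, of spin $s$, the vector $\sqrt{\frac{s}{2s+1}}\,|\tilde k,s,s-\frac12,s,m\rangle-\sqrt{\frac{s+1}{2s+1}}\,|\tilde k,s,s+\frac12,s,m\rangle$ (for $s=0$ the first term is absent) is an eigenvector of $\Pi_N$ with eigenvalue $\sigma(s)=\frac{4}{N+3+2s}$. The eigenvalue is $0$ elsewhere: the Schur states with $k_{N-2}\ne s$, and, for $s\ge\frac12$, the vectors $\sqrt{\frac{s+1}{2s+1}}\,|\tilde k,s,s-\frac12,s,m\rangle+\sqrt{\frac{s}{2s+1}}\,|\tilde k,s,s+\frac12,s,m\rangle$ are eigenvectors of $\Pi_N$ with eigenvalue $0$, and $\Pi_N$ annihilates every vector orthogonal to all the eigenvectors with eigenvalue $\sigma(s)$ listed above. 3. For $1\le i\le N$, $\Pi_i=\mathrm{SWAP}_{A_iA_N}\Pi_N\,\mathrm{SWAP}_{A_iA_N}$, so $\mathrm{SWAP}_{A_iA_N}$ maps eigenvectors of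 $\Pi_N$ to eigenvectors of $\Pi_i$ with the same eigenvalue. 4. $\Pi_{N+1}$ is diagonal in the Schur basis: a Schur state with $s=j+\frac12$ is an eigenvector with eigenvalue $\tau(s)=\frac{2(2s+1)}{N+3+2s}$, and one with $s=j-\frac12$ is an eigenvector with eigenvalue $0$. -/

import Mathlib

/-!
Spins are stored doubled: a natural number `d` stands for the total spin `d / 2`, an integer `z`
for the `Z`-spin `z / 2`.  The computational state `|0⟩` is `Z`-spin `+1/2`, `|1⟩` is `-1/2`.
Qubits are numbered from `0`.
-/

namespace PBT

noncomputable section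

/-- The Hilbert space `(ℂ²)^{⊗ n}` of `n` qubits, in the computational basis. -/
abbrev Qubits (n : ℕ) : Type := EuclideanSpace ℂ (Fin n → Fin 2)

/-- Operators on `n` qubits, as matrices in the computational basis. -/
abbrev Op (n : ℕ) : Type := Matrix (Fin n → Fin 2) (Fin n → Fin 2) ℂ

/-- The endomorphism of the Hilbert space given by a matrix. -/
abbrev Op.toEnd {n : ℕ} (A : Op n) : Module.End ℂ (Qubits n) := Matrix.toEuclideanLin A

/-! ### Angular momentum -/

/-- The three Pauli matrices `σ_x, σ_y, σ_z`. -/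
def pauli : Fin 3 → Matrix (Fin 2) (Fin 2) ℂ :=
  ![!![0, 1; 1, 0], !![0, -Complex.I; Complex.I, 0], !![1, 0; 0, -1]]

/-- The one-qubit operator `A` acting on qubit `i`, and the identity on the other qubits. -/
def onQubit {n : ℕ} (A : Matrix (Fin 2) (Fin 2) ℂ) (i : Fin n) : Op n :=
  fun x y => if ∀ k, k ≠ i → x k = y k then A (x i) (y i) else 0

/-- Component `c` of the angular momentum `∑_{i ∈ a} S^{(i)}` of the subset `a` of the qubits. -/
def angMom {n : ℕ} (a : Finset (Fin n)) (c : Fin 3) : Op n :=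
  ∑ i ∈ a, (1 / 2 : ℂ) • onQubit (pauli c) i

/-- The total angular momentum operator `S²_a`. -/
def spinSq {n : ℕ} (a : Finset (Fin n)) : Op n :=
  ∑ c : Fin 3, angMom a c * angMom a c

/-- The `Z`-angular momentum operator `Z_a`. -/
def spinZ {n : ℕ} (a : Finset (Fin n)) : Op n := angMom a 2

/-- The eigenvalue `s (s + 1)` of `S²` for the spin `s = d / 2`. -/
def casimir (d : ℕ) : ℂ := ((d : ℂ) / 2) * ((d : ℂ) / 2 + 1)

/-- `𝕀(s)`: the orthogonal projector onto the subspace of `n` qubits with total spin `s = d / 2`. -/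
def spinProj (n d : ℕ) : Op n :=
  Matrix.toEuclideanLin.symm
    ((Module.End.eigenspace (spinSq (Finset.univ : Finset (Fin n))).toEnd
      (casimir d)).starProjection : Qubits n →L[ℂ] Qubits n).toLinearMap

/-! ### The Schur basis -/

/-- Twice the `Z`-spin of the computational state `|b⟩`. -/
def bitZ (b : Fin 2) : ℤ := if b = 0 then 1 else -1

/-- The Clebsch-Gordan coefficient `C^{J, M}_{j, M - x; 1/2, x}` for coupling a spin `j = a / 2`
with a qubit of `Z`-spin `x = ± 1/2` (the bit `b`) to spin `J = a' / 2` and `Z`-spin `M = z / 2`. -/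
def cg (a a' : ℕ) (z : ℤ) (b : Fin 2) : ℝ :=
  let r : ℝ := ((z : ℝ) / 2) / ((a : ℝ) / 2 + 1 / 2)
  if a' = a + 1 then
    (if b = 0 then √(1 / 2 * (1 + r)) else √(1 / 2 * (1 - r)))
  else if a' + 1 = a then
    (if b = 0 then -√(1 / 2 * (1 - r)) else √(1 / 2 * (1 + r)))
  else 0

/-- Amplitudes of the Schur state of `n` qubits whose first `r` qubits have total spin `t r / 2`
for every `r ≤ n`, with `Z`-spin `z / 2`.  The qubits are coupled one after the other:
`|…, j, J, M⟩ = ∑_x C^{J, M}_{j, M - x; 1/2, x} |…, j, M - x⟩ |x⟩`. -/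
def schurAmp : (n : ℕ) → (Fin (n + 1) → ℕ) → ℤ → (Fin n → Fin 2) → ℂ
  | 0, _, z, _ => if z = 0 then 1 else 0
  | n + 1, t, z, x =>
      (cg (t (Fin.last n).castSucc) (t (Fin.last (n + 1))) z (x (Fin.last n)) : ℂ) *
        schurAmp n (fun r => t r.castSucc) (z - bitZ (x (Fin.last n))) (fun i => x i.castSucc)

/-- The Schur state with spins `t` and `Z`-spin `z` (both doubled). -/
def schurState {n : ℕ} (t : Fin (n + 1) → ℕ) (z : ℤ) : Qubits n :=
  WithLp.toLp 2 (schurAmp n t z)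

/-- The admissible labels of the Schur states of `n` qubits: `spin r` is twice the total spin of
the first `r` qubits (`0` for no qubits), successive spins differ by `1/2`, and the `Z`-spin runs
through `-j, -j + 1, …, j`, where `j` is the spin of all the qubits. -/
@[ext]
structure SchurLabel (n : ℕ) where
  spin : Fin (n + 1) → ℕ
  zspin : ℤ
  spin_zero : spin 0 = 0
  spin_step : ∀ i : Fin n,
    spin i.succ = spin i.castSucc + 1 ∨ spin i.succ + 1 = spin i.castSucc
  zspin_le : |zspin| ≤ (spin (Fin.last n) : ℤ)
  zspin_parity : Even (zspin - (spin (Fin.last n) : ℤ))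

/-- The Schur state of an admissible label. -/
def SchurLabel.state {n : ℕ} (l : SchurLabel n) : Qubits n := schurState l.spin l.zspin

/-- Twice the spin of all the qubits. -/
def SchurLabel.total {n : ℕ} (l : SchurLabel n) : ℕ := l.spin (Fin.last n)

/-- For the label `(k̃, s, m)` of `n` qubits, the state `|k̃, s, j, s, m⟩` of `n + 2` qubits, in
which the first `n + 1` qubits have spin `j = a / 2` and all `n + 2` qubits have again spin `s`. -/
def SchurLabel.extend {n : ℕ} (l : SchurLabel n) (a : ℕ) : Qubits (n + 2) :=
  schurState
    (Fin.snoc (α := fun _ => ℕ) (Fin.snoc (α := fun _ => ℕ) l.spin a) l.total) l.zspin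

/-! ### The measurement

There are `N = n + 1` ports `A_1, …, A_N` (the qubits `0, …, n`) and the input qubit `A_{N+1}`
(the qubit `n + 1`). -/

/-- The singlet `|ψ⁻⟩ = (|01⟩ - |10⟩) / √2`. -/
def singlet (a b : Fin 2) : ℂ :=
  if a = 0 ∧ b = 1 then 1 / (√2 : ℝ) else if a = 1 ∧ b = 0 then -(1 / (√2 : ℝ)) else 0

/-- `λ⁺_j = 2^{-N} (N / 2 + j + 1)`. -/
def lambdaPlus (N : ℕ) (j : ℝ) : ℝ := 1 / 2 ^ N * ((N : ℝ) / 2 + j + 1)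

/-- `Θ̃ = 2^{-(N-1)} ∑_s 𝕀(s) / λ⁺_{s + 1/2}` on `N - 1 = n` qubits, where `s = d / 2` runs through
`s_min, s_min + 1, …, (N - 1) / 2`. -/
def theta (n : ℕ) : Op n :=
  (1 / 2 ^ n : ℂ) • ∑ d ∈ (Finset.range (n + 1)).filter (fun d => d % 2 = n % 2),
    ((1 / lambdaPlus (n + 1) ((d : ℝ) / 2 + 1 / 2) : ℝ) : ℂ) • spinProj n d

/-- `Π_i = |ψ⁻⟩⟨ψ⁻|_{A_i A_{N+1}} ⊗ Θ̃_{Ā_i}`, where `Ā_i` are the ports other than `A_i`. -/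
def povm {n : ℕ} (i : Fin (n + 1)) : Op (n + 2) :=
  fun x y =>
    singlet (x i.castSucc) (x (Fin.last (n + 1))) *
      star (singlet (y i.castSucc) (y (Fin.last (n + 1)))) *
      theta n (fun l => x (i.succAbove l).castSucc) (fun l => y (i.succAbove l).castSucc)

/-- The failure element `Π_{N+1} = I - ∑_{i=1}^N Π_i`. -/
def povmFail (n : ℕ) : Op (n + 2) := 1 - ∑ i : Fin (n + 1), povm i

/-- The operator that swaps the qubits `i` and `j`. -/
def swapOp {n : ℕ} (i j : Fin n) : Op n :=
  fun x y => if x = y ∘ Equiv.swap i j then 1 else 0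

/-- `√(s/(2s+1)) |k̃, s, s - 1/2, s, m⟩ - √((s+1)/(2s+1)) |k̃, s, s + 1/2, s, m⟩`.
For `s = 0` there is no state with `j = s - 1/2`; that term has coefficient `0`. -/
def SchurLabel.sigmaVec {n : ℕ} (l : SchurLabel n) : Qubits (n + 2) :=
  let s : ℝ := (l.total : ℝ) / 2
  ((√(s / (2 * s + 1)) : ℝ) : ℂ) • l.extend (l.total - 1) -
    ((√((s + 1) / (2 * s + 1)) : ℝ) : ℂ) • l.extend (l.total + 1)

/-- `√((s+1)/(2s+1)) |k̃, s, s - 1/2, s, m⟩ + √(s/(2s+1)) |k̃, s, s + 1/2, s, m⟩`, used for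
`s ≥ 1/2` only. -/
def SchurLabel.nullVec {n : ℕ} (l : SchurLabel n) : Qubits (n + 2) :=
  let s : ℝ := (l.total : ℝ) / 2
  ((√((s + 1) / (2 * s + 1)) : ℝ) : ℂ) • l.extend (l.total - 1) +
    ((√(s / (2 * s + 1)) : ℝ) : ℂ) • l.extend (l.total + 1)

end

end PBT

/-! Appending a qubit turns a collective operator into the old one plus a one-qubit term, so the
recursion for the Schur states reduces their properties to identities between Clebsch–Gordan
coefficients. By induction on the number of qubits, the collective raising and lowering operators
act with the usual factors √((j ∓ m)(j ± m + 1)) (`raise_mulVec_schurAmp`, `lower_mulVec_schurAmp`).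
Since S² = ½(S₊S₋ + S₋S₊) + Z², the Schur states are joint eigenvectors. The two orthogonality
relations of the coefficients give orthonormality (`star_schurAmp_dotProduct`) and completeness
(`span_schurAmp`).

Let E be the isometry φ ↦ φ ⊗ ψ⁻ from N - 1 to N + 1 qubits. Then Π_N = E Θ̃ E†
(`povm_last_mulVec`), and Θ̃ is the scalar σ(s) on spin s (`theta_mulVec_of_spinSq`). The listed
eigenvectors are -Eφ with φ a Schur state (`recoupling`, `SchurLabel.sigmaVec_eq`). A vector
orthogonal to all of them is killed by E†, because the φ span, and hence by Π_N.

The swap relation holds because S², and with it Θ̃, is invariant under permutations of the qubits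
(`theta_submatrix`).

For Π_{N+1}: the singlet carries no angular momentum, so E† preserves the spin, and on total spin s
each Π_i is σ(s) times the singlet projector 1/4 - S_i · S_{N+1} (`povm_mulVec_of_spinSq`). The sum
of these projectors is a combination of 1, S² of all qubits and S² of the ports (`sum_singletProj`),
which are diagonal in the Schur basis. -/

namespace PBT

noncomputable section

open Matrix

/-! ### Collective operators and the last qubit -/

/-- The vector `v ⊗ |b⟩`. -/
def snocQubit {n : ℕ} (b : Fin 2) :
    ((Fin n → Fin 2) → ℂ) →ₗ[ℂ] ((Fin (n + 1) → Fin 2) → ℂ) where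
  toFun v x := if x (Fin.last n) = b then v (fun i => x i.castSucc) else 0
  map_add' u v := by ext x; simp only [Pi.add_apply]; split_ifs <;> simp
  map_smul' c v := by ext x; simp only [Pi.smul_apply]; split_ifs <;> simp

theorem snocQubit_apply {n : ℕ} (b : Fin 2) (v : (Fin n → Fin 2) → ℂ) (x : Fin (n + 1) → Fin 2) :
    snocQubit b v x = if x (Fin.last n) = b then v (fun i => x i.castSucc) else 0 := rfl

theorem eq_sum_snocQubit {n : ℕ} (v : (Fin (n + 1) → Fin 2) → ℂ) :
    v = ∑ b, snocQubit b (fun x => v (Fin.snoc (α := fun _ => Fin 2) x b)) := by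
  ext x
  simp only [Finset.sum_apply, snocQubit_apply, Finset.sum_ite_eq, Finset.mem_univ, if_true]
  exact congrArg v (Fin.snoc_init_self x).symm

theorem sum_snoc {M : Type*} [AddCommMonoid M] {n : ℕ} (f : (Fin (n + 1) → Fin 2) → M) :
    ∑ x, f x = ∑ b, ∑ x : Fin n → Fin 2, f (Fin.snoc (α := fun _ => Fin 2) x b) := by
  rw [← (Fin.snocEquiv (fun _ : Fin (n + 1) => Fin 2)).sum_comp, Fintype.sum_prod_type]
  rfl

theorem onQubit_mulVec {n : ℕ} (A : Matrix (Fin 2) (Fin 2) ℂ) (i : Fin n)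
    (v : (Fin n → Fin 2) → ℂ) (x : Fin n → Fin 2) :
    (onQubit A i *ᵥ v) x = ∑ b, A (x i) b * v (Function.update x i b) := by
  simp only [mulVec, dotProduct, onQubit, ite_mul, zero_mul]
  rw [← Finset.sum_filter]
  symm
  refine Finset.sum_bij' (fun b _ => Function.update x i b) (fun y _ => y i) ?_ ?_ ?_ ?_ ?_
  · intro b _
    simp only [Finset.mem_filter, Finset.mem_univ, true_and]
    intro k hk
    rw [Function.update_of_ne hk]
  · simp
  · simp
  · intro y hy
    simp only [Finset.mem_filter, Finset.mem_univ, true_and] at hy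
    ext k
    by_cases hk : k = i
    · subst hk; simp
    · rw [Function.update_of_ne hk, hy k hk]
  · simp

theorem onQubit_castSucc_mulVec_snocQubit {n : ℕ} (A : Matrix (Fin 2) (Fin 2) ℂ) (i : Fin n)
    (b : Fin 2) (v : (Fin n → Fin 2) → ℂ) :
    onQubit A i.castSucc *ᵥ snocQubit b v = snocQubit b (onQubit A i *ᵥ v) := by
  ext x
  rw [onQubit_mulVec, snocQubit_apply, onQubit_mulVec]
  simp only [snocQubit_apply, ne_eq, (Fin.castSucc_lt_last i).ne', not_false_eq_true,
    Function.update_of_ne]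
  split_ifs
  · refine Finset.sum_congr rfl fun c _ => ?_
    congr 2
    ext k
    simp [Function.update_apply]
  · simp

theorem onQubit_last_mulVec_snocQubit {n : ℕ} (A : Matrix (Fin 2) (Fin 2) ℂ)
    (b : Fin 2) (v : (Fin n → Fin 2) → ℂ) :
    onQubit A (Fin.last n) *ᵥ snocQubit b v = ∑ c, A c b • snocQubit c v := by
  ext x
  rw [onQubit_mulVec]
  simp only [snocQubit_apply, Function.update_self, Finset.sum_apply, Pi.smul_apply, smul_eq_mul,
    mul_ite, mul_zero, Finset.sum_ite_eq', Finset.sum_ite_eq, Finset.mem_univ, if_true]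
  congr 2
  ext k
  rw [Function.update_of_ne (Fin.castSucc_lt_last k).ne]

theorem onQubit_smul {n : ℕ} (c : ℂ) (A : Matrix (Fin 2) (Fin 2) ℂ) (i : Fin n) :
    onQubit (c • A) i = c • onQubit A i := by
  ext x y; simp only [onQubit, Matrix.smul_apply]; split_ifs <;> simp

theorem onQubit_add {n : ℕ} (A B : Matrix (Fin 2) (Fin 2) ℂ) (i : Fin n) :
    onQubit (A + B) i = onQubit A i + onQubit B i := by
  ext x y; simp only [onQubit, Matrix.add_apply]; split_ifs <;> simp

/-- The collective operator `∑_i A^{(i)}`. -/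
def collective (n : ℕ) (A : Matrix (Fin 2) (Fin 2) ℂ) : Op n := ∑ i, onQubit A i

theorem collective_smul (n : ℕ) (c : ℂ) (A : Matrix (Fin 2) (Fin 2) ℂ) :
    collective n (c • A) = c • collective n A := by
  simp [collective, onQubit_smul, Finset.smul_sum]

theorem collective_add (n : ℕ) (A B : Matrix (Fin 2) (Fin 2) ℂ) :
    collective n (A + B) = collective n A + collective n B := by
  simp [collective, onQubit_add, Finset.sum_add_distrib]

theorem collective_mulVec_snocQubit {n : ℕ} (A : Matrix (Fin 2) (Fin 2) ℂ) (b : Fin 2)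
    (v : (Fin n → Fin 2) → ℂ) :
    collective (n + 1) A *ᵥ snocQubit b v =
      snocQubit b (collective n A *ᵥ v) + ∑ c, A c b • snocQubit c v := by
  simp only [collective, Fin.sum_univ_castSucc, add_mulVec, sum_mulVec,
    onQubit_castSucc_mulVec_snocQubit, onQubit_last_mulVec_snocQubit, map_sum]

theorem angMom_univ (n : ℕ) (c : Fin 3) :
    angMom (Finset.univ : Finset (Fin n)) c = collective n ((1 / 2 : ℂ) • pauli c) := by
  simp [angMom, collective, onQubit_smul]

/-- The first `r` of `n` qubits. -/
abbrev firstQubits (n r : ℕ) : Finset (Fin n) := Finset.univ.filter fun i => (i : ℕ) < r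

theorem angMom_firstQubits_mulVec_snocQubit {n r : ℕ} (hr : r ≤ n) (c : Fin 3) (b : Fin 2)
    (v : (Fin n → Fin 2) → ℂ) :
    angMom (firstQubits (n + 1) r) c *ᵥ snocQubit b v =
      snocQubit b (angMom (firstQubits n r) c *ᵥ v) := by
  simp only [angMom, firstQubits, Finset.sum_filter, Fin.sum_univ_castSucc, Fin.val_castSucc,
    Fin.val_last, not_lt.mpr hr, if_false, add_zero, sum_mulVec, map_sum]
  refine Finset.sum_congr rfl fun i _ => ?_
  split_ifs
  · rw [smul_mulVec, smul_mulVec, map_smul, onQubit_castSucc_mulVec_snocQubit]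
  · simp

theorem spinSq_firstQubits_mulVec_snocQubit {n r : ℕ} (hr : r ≤ n) (b : Fin 2)
    (v : (Fin n → Fin 2) → ℂ) :
    spinSq (firstQubits (n + 1) r) *ᵥ snocQubit b v =
      snocQubit b (spinSq (firstQubits n r) *ᵥ v) := by
  simp only [spinSq, sum_mulVec, map_sum, ← mulVec_mulVec,
    angMom_firstQubits_mulVec_snocQubit hr]

theorem firstQubits_self (n : ℕ) : firstQubits n n = Finset.univ := by
  ext i; simp

/-- The one-qubit raising operator `|0⟩⟨1|`. -/
def raiseMat : Matrix (Fin 2) (Fin 2) ℂ := !![0, 1; 0, 0]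

/-- The one-qubit lowering operator `|1⟩⟨0|`. -/
def lowerMat : Matrix (Fin 2) (Fin 2) ℂ := !![0, 0; 1, 0]

/-- With S_x = ½(S₊ + S₋) and S_y = (i/2)(S₋ - S₊), the terms S₊² and S₋² cancel in S_x² + S_y². In
the symmetric form that remains, S² follows from the two ladder actions without any commutation
relation. -/
theorem spinSq_univ (n : ℕ) :
    spinSq (Finset.univ : Finset (Fin n)) =
      (1 / 2 : ℂ) • (collective n raiseMat * collective n lowerMat +
        collective n lowerMat * collective n raiseMat) +
      spinZ Finset.univ * spinZ Finset.univ := by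
  have hx : (1 / 2 : ℂ) • pauli 0 = (1 / 2 : ℂ) • (raiseMat + lowerMat) := by
    congr 1
    ext i j; fin_cases i <;> fin_cases j <;> simp [pauli, raiseMat, lowerMat]
  have hy : (1 / 2 : ℂ) • pauli 1 =
      (Complex.I / 2) • (lowerMat + (-1 : ℂ) • raiseMat) := by
    ext i j; fin_cases i <;> fin_cases j <;> simp [pauli, raiseMat, lowerMat] <;> ring
  have hI : Complex.I / 2 * (Complex.I / 2) = -(1 / 4) := by
    linear_combination (1 / 4) * Complex.I_mul_I
  rw [spinSq, spinZ, Fin.sum_univ_three, angMom_univ, angMom_univ, hx, hy]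
  simp only [collective_smul, smul_mul_smul_comm, hI]
  simp only [collective_smul, collective_add, mul_add, add_mul, smul_mul_assoc, mul_smul_comm,
    smul_add, smul_smul]
  module

/-! ### Schur states -/

/-- Spins of initial segments: they start with `0`, and successive ones differ by `1/2`. -/
def IsSpinPath {n : ℕ} (t : Fin (n + 1) → ℕ) : Prop :=
  t 0 = 0 ∧ ∀ i : Fin n, t i.succ = t i.castSucc + 1 ∨ t i.succ + 1 = t i.castSucc

theorem IsSpinPath.init {n : ℕ} {t : Fin (n + 2) → ℕ} (h : IsSpinPath t) :
    IsSpinPath (fun r : Fin (n + 1) => t r.castSucc) :=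
  ⟨h.1, fun i => h.2 i.castSucc⟩

theorem IsSpinPath.step_last {n : ℕ} {t : Fin (n + 2) → ℕ} (h : IsSpinPath t) :
    t (Fin.last (n + 1)) = t (Fin.last n).castSucc + 1 ∨
      t (Fin.last (n + 1)) + 1 = t (Fin.last n).castSucc :=
  h.2 (Fin.last n)

theorem IsSpinPath.snoc {n : ℕ} {t : Fin (n + 1) → ℕ} (h : IsSpinPath t) {a : ℕ}
    (ha : a = t (Fin.last n) + 1 ∨ a + 1 = t (Fin.last n)) :
    IsSpinPath (Fin.snoc (α := fun _ => ℕ) t a : Fin (n + 2) → ℕ) := by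
  refine ⟨?_, fun i => ?_⟩
  · rw [← Fin.castSucc_zero, Fin.snoc_castSucc]; exact h.1
  · rw [Fin.snoc_castSucc]
    induction i using Fin.lastCases with
    | last => rw [Fin.succ_last, Fin.snoc_last]; exact ha
    | cast i => rw [← Fin.castSucc_succ, Fin.snoc_castSucc]; exact h.2 i

/-- The (doubled) `Z`-spins that a state of (doubled) spin `a` can have. -/
def IsZSpin (a : ℕ) (z : ℤ) : Prop := |z| ≤ (a : ℤ) ∧ Even (z - a)

theorem SchurLabel.isSpinPath {n : ℕ} (l : SchurLabel n) : IsSpinPath l.spin :=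
  ⟨l.spin_zero, l.spin_step⟩

theorem SchurLabel.isZSpin {n : ℕ} (l : SchurLabel n) : IsZSpin l.total l.zspin :=
  ⟨l.zspin_le, l.zspin_parity⟩

theorem schurAmp_succ {n : ℕ} (t : Fin (n + 2) → ℕ) (z : ℤ) :
    schurAmp (n + 1) t z = ∑ b, (cg (t (Fin.last n).castSucc) (t (Fin.last (n + 1))) z b : ℂ) •
      snocQubit b (schurAmp n (fun r => t r.castSucc) (z - bitZ b)) := by
  ext x
  simp [schurAmp, snocQubit_apply]

/-! ### Clebsch–Gordan coefficients and impossible `Z`-spins -/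

theorem cg_raise_zero (a : ℕ) (z : ℤ) :
    cg a (a + 1) z 0 = √((a + 1 + z) / (2 * (a + 1))) := by
  have : (a : ℝ) + 1 ≠ 0 := by positivity
  simp only [cg, if_true]
  congr 1; field_simp

theorem cg_raise_one (a : ℕ) (z : ℤ) :
    cg a (a + 1) z 1 = √((a + 1 - z) / (2 * (a + 1))) := by
  have : (a : ℝ) + 1 ≠ 0 := by positivity
  simp only [cg, if_true, one_ne_zero, if_false]
  congr 1; field_simp

theorem cg_lower_zero (a : ℕ) (z : ℤ) :
    cg (a + 1) a z 0 = -√((a + 2 - z) / (2 * (a + 2))) := by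
  have : (a : ℝ) + 2 ≠ 0 := by positivity
  simp only [cg, if_true, show a ≠ a + 1 + 1 by omega, if_false]
  congr 2; push_cast; rw [show ((a:ℝ) + 1) / 2 + 1 / 2 = (a + 2) / 2 by ring]; field_simp

theorem cg_lower_one (a : ℕ) (z : ℤ) :
    cg (a + 1) a z 1 = √((a + 2 + z) / (2 * (a + 2))) := by
  have : (a : ℝ) + 2 ≠ 0 := by positivity
  simp only [cg, if_true, one_ne_zero, show a ≠ a + 1 + 1 by omega, if_false]
  congr 1; push_cast; rw [show ((a:ℝ) + 1) / 2 + 1 / 2 = (a + 2) / 2 by ring]; field_simp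

theorem bitZ_zero : bitZ 0 = 1 := rfl

theorem bitZ_one : bitZ 1 = -1 := rfl

/-- A Schur state with an impossible `Z`-spin vanishes. -/
theorem schurAmp_eq_zero {n : ℕ} {t : Fin (n + 1) → ℕ} (ht : IsSpinPath t) {z : ℤ}
    (hz : ¬ IsZSpin (t (Fin.last n)) z) : schurAmp n t z = 0 := by
  induction n generalizing z with
  | zero =>
    ext x
    have h0 : t (Fin.last 0) = 0 := ht.1
    have : z ≠ 0 := by rintro rfl; exact hz (by rw [h0]; simp [IsZSpin])
    simp [schurAmp, this]
  | succ n ih =>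
    rw [schurAmp_succ]
    refine Finset.sum_eq_zero fun b _ => ?_
    by_cases hb : IsZSpin (t (Fin.last n).castSucc) (z - bitZ b)
    · convert zero_smul ℂ _
      rw [Complex.ofReal_eq_zero]
      obtain ⟨h1, h2⟩ := hb
      rw [abs_le] at h1
      rcases ht.step_last with h | h
      · exfalso; apply hz
        rw [h]
        refine ⟨?_, ?_⟩
        · rw [abs_le]; revert h1; fin_cases b <;> simp [bitZ] <;> omega
        · revert h2; fin_cases b <;> simp [bitZ] <;> grind
      · rw [← h] at h1 h2 ⊢
        -- When the last step lowers the spin, the shorter state can exist while `z` is impossible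
        -- only if `z` overshoots the range by exactly two; there the radicand of the coefficient is
        -- zero.
        have hz' : z = t (Fin.last (n + 1)) + 2 ∧ b = 0 ∨
            z = -(t (Fin.last (n + 1)) + 2 : ℤ) ∧ b = 1 := by
          by_contra hne
          apply hz
          refine ⟨?_, ?_⟩
          · rw [abs_le]
            revert h1 h2 hne
            fin_cases b <;> simp [bitZ, Int.even_iff] <;> omega
          · revert h2; fin_cases b <;> simp [bitZ] <;> grind
        rcases hz' with ⟨rfl, rfl⟩ | ⟨rfl, rfl⟩
        · rw [cg_lower_zero]; simp
        · rw [cg_lower_one]; simp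
    · rw [ih ht.init hb]; simp

theorem spinZ_mulVec_schurAmp {n : ℕ} (t : Fin (n + 1) → ℕ) (z : ℤ) :
    spinZ Finset.univ *ᵥ schurAmp n t z = ((z : ℂ) / 2) • schurAmp n t z := by
  induction n generalizing z with
  | zero =>
    ext x
    by_cases h : z = 0 <;> simp [schurAmp, spinZ, angMom, h]
  | succ n ih =>
    simp only [spinZ, angMom_univ] at ih ⊢
    rw [schurAmp_succ]
    simp only [Fin.sum_univ_two, mulVec_add, mulVec_smul, collective_mulVec_snocQubit, ih, map_smul,
      bitZ_zero, bitZ_one]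
    simp [pauli]
    module

/-! ### Ladder operators on Schur states -/

/-- The matrix element of the raising operator between the `Z`-spins `z / 2` and `z / 2 + 1`. -/
def ladder (a : ℕ) (z : ℤ) : ℝ := √((a - z) * (a + z + 2)) / 2

/-- Here p = j + m + 1 and q = j - m. One sign is enough, since `Real.sqrt` splits a product as soon
as one factor is nonnegative; this covers the extreme `Z`-spins, where the other factor may be
negative. -/
theorem ladder_eq {a : ℕ} {z : ℤ} {p q : ℝ} (hq : (a : ℝ) - z = 2 * q)
    (hp : (a : ℝ) + z + 2 = 2 * p) (h0 : 0 ≤ p ∨ 0 ≤ q) : ladder a z = √q * √p := by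
  have h4 : √(4 : ℝ) = 2 := by rw [show (4 : ℝ) = 2 ^ 2 by norm_num]; simp
  rw [ladder, hq, hp, show 2 * q * (2 * p) = 4 * (q * p) by ring,
    Real.sqrt_mul (by norm_num), h4, mul_div_cancel_left₀ _ two_ne_zero]
  rcases h0 with h0 | h0
  · exact Real.sqrt_mul' q h0
  · exact Real.sqrt_mul h0 p

theorem cg_raise_zero_eq {a : ℕ} {z : ℤ} {p : ℝ} (h : (a : ℝ) + 1 + z = 2 * p) :
    cg a (a + 1) z 0 = √p / √(a + 1) := by
  rw [cg_raise_zero, h, mul_div_mul_left _ _ two_ne_zero, Real.sqrt_div' _ (by positivity)]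

theorem cg_raise_one_eq {a : ℕ} {z : ℤ} {p : ℝ} (h : (a : ℝ) + 1 - z = 2 * p) :
    cg a (a + 1) z 1 = √p / √(a + 1) := by
  rw [cg_raise_one, h, mul_div_mul_left _ _ two_ne_zero, Real.sqrt_div' _ (by positivity)]

theorem cg_lower_zero_eq {a : ℕ} {z : ℤ} {p : ℝ} (h : (a : ℝ) + 2 - z = 2 * p) :
    cg (a + 1) a z 0 = -(√p / √(a + 2)) := by
  rw [cg_lower_zero, h, mul_div_mul_left _ _ two_ne_zero, Real.sqrt_div' _ (by positivity)]

theorem cg_lower_one_eq {a : ℕ} {z : ℤ} {p : ℝ} (h : (a : ℝ) + 2 + z = 2 * p) :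
    cg (a + 1) a z 1 = √p / √(a + 2) := by
  rw [cg_lower_one, h, mul_div_mul_left _ _ two_ne_zero, Real.sqrt_div' _ (by positivity)]

theorem IsZSpin.exists_nat {a : ℕ} {z : ℤ} (h : IsZSpin a z) :
    ∃ p q : ℕ, p + q = a ∧ z = (p : ℤ) - q := by
  obtain ⟨h1, r, hr⟩ := h
  rw [abs_le] at h1
  exact ⟨(a + r).toNat, (-r).toNat, by omega, by omega⟩

/-- The parameters are p = j + m and q = j - m. In them every radicand of a Clebsch–Gordan
coefficient is p or q plus a constant, up to the common denominator. -/
theorem IsZSpin.exists_real {a : ℕ} {z : ℤ} (h : IsZSpin a z) :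
    ∃ p q : ℝ, 0 ≤ p ∧ 0 ≤ q ∧ (a : ℝ) = p + q ∧ (z : ℝ) = p - q := by
  obtain ⟨p, q, rfl, rfl⟩ := h.exists_nat
  exact ⟨p, q, by positivity, by positivity, by push_cast; ring, by push_cast; ring⟩

/-- Raising the `Z`-spin after coupling another qubit: the component `|0⟩` of that qubit. -/
theorem raise_cg_zero {a a' : ℕ} (h : a' = a + 1 ∨ a' + 1 = a) {z : ℤ}
    (hz : IsZSpin a (z + 1)) :
    cg a a' z 0 * ladder a (z - 1) + cg a a' z 1 = ladder a' z * cg a a' (z + 2) 0 := by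
  obtain ⟨p, q, hp, hq, ha, hz⟩ := hz.exists_real
  push_cast at hz
  rcases h with rfl | rfl
  · rw [cg_raise_zero_eq (p := p) (by linarith), cg_raise_one_eq (p := q + 1) (by linarith),
      cg_raise_zero_eq (p := p + 1) (by push_cast; linarith),
      ladder_eq (p := p) (q := q + 1) (by push_cast; linarith) (by push_cast; linarith) (.inl hp),
      ladder_eq (p := p + 1) (q := q + 1) (by push_cast; linarith) (by push_cast; linarith)
        (.inl (by linarith))]
    field_simp
    rw [Real.sq_sqrt hp, Real.sq_sqrt (by linarith)]
  · push_cast at ha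
    rw [cg_lower_zero_eq (p := q + 1) (by linarith), cg_lower_one_eq (p := p) (by linarith),
      cg_lower_zero_eq (p := q) (by push_cast; linarith),
      ladder_eq (p := p) (q := q + 1) (by push_cast; linarith) (by push_cast; linarith) (.inl hp),
      ladder_eq (p := p) (q := q) (by linarith) (by linarith) (.inl hp)]
    field_simp
    rw [Real.sq_sqrt hq, Real.sq_sqrt (by linarith)]
    ring

/-- Raising the `Z`-spin after coupling another qubit: the component `|1⟩` of that qubit. -/
theorem raise_cg_one {a a' : ℕ} (h : a' = a + 1 ∨ a' + 1 = a) {z : ℤ}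
    (hz : IsZSpin a (z + 3)) :
    cg a a' z 1 * ladder a (z + 1) = ladder a' z * cg a a' (z + 2) 1 := by
  obtain ⟨p, q, hp, hq, ha, hz⟩ := hz.exists_real
  push_cast at hz
  rcases h with rfl | rfl
  · rw [cg_raise_one_eq (p := q + 2) (by linarith),
      cg_raise_one_eq (p := q + 1) (by push_cast; linarith),
      ladder_eq (p := p) (q := q + 1) (by push_cast; linarith) (by push_cast; linarith) (.inl hp),
      ladder_eq (p := p) (q := q + 2) (by push_cast; linarith) (by push_cast; linarith) (.inl hp)]
    ring
  · push_cast at ha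
    -- The number `p - 1` may be negative; the coefficient formula needs no sign, and `ladder_eq`
    -- uses that of `q + 1`.
    rw [cg_lower_one_eq (p := p - 1) (by linarith),
      cg_lower_one_eq (p := p) (by push_cast; linarith),
      ladder_eq (p := p) (q := q + 1) (by push_cast; linarith) (by push_cast; linarith) (.inl hp),
      ladder_eq (p := p - 1) (q := q + 1) (by linarith) (by linarith)
        (.inr (by linarith))]
    ring

/-- Lowering the `Z`-spin after coupling another qubit: the component `|0⟩` of that qubit. -/
theorem lower_cg_zero {a a' : ℕ} (h : a' = a + 1 ∨ a' + 1 = a) {z : ℤ}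
    (hz : IsZSpin a (z - 3)) :
    cg a a' z 0 * ladder a (z - 3) = ladder a' (z - 2) * cg a a' (z - 2) 0 := by
  obtain ⟨p, q, hp, hq, ha, hz⟩ := hz.exists_real
  push_cast at hz
  rcases h with rfl | rfl
  · rw [cg_raise_zero_eq (p := p + 2) (by linarith),
      cg_raise_zero_eq (p := p + 1) (by push_cast; linarith),
      ladder_eq (p := p + 1) (q := q) (by push_cast; linarith) (by push_cast; linarith) (.inr hq),
      ladder_eq (p := p + 2) (q := q) (by push_cast; linarith) (by push_cast; linarith) (.inr hq)]
    ring
  · push_cast at ha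
    rw [cg_lower_zero_eq (p := q - 1) (by linarith),
      cg_lower_zero_eq (p := q) (by push_cast; linarith),
      ladder_eq (p := p + 1) (q := q) (by push_cast; linarith) (by push_cast; linarith) (.inr hq),
      ladder_eq (p := p + 1) (q := q - 1) (by push_cast; linarith) (by push_cast; linarith)
        (.inl (by linarith))]
    ring

/-- Lowering the `Z`-spin after coupling another qubit: the component `|1⟩` of that qubit. -/
theorem lower_cg_one {a a' : ℕ} (h : a' = a + 1 ∨ a' + 1 = a) {z : ℤ}
    (hz : IsZSpin a (z - 1)) :
    cg a a' z 1 * ladder a (z - 1) + cg a a' z 0 = ladder a' (z - 2) * cg a a' (z - 2) 1 := by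
  obtain ⟨p, q, hp, hq, ha, hz⟩ := hz.exists_real
  push_cast at hz
  rcases h with rfl | rfl
  · rw [cg_raise_one_eq (p := q) (by linarith), cg_raise_zero_eq (p := p + 1) (by linarith),
      cg_raise_one_eq (p := q + 1) (by push_cast; linarith),
      ladder_eq (p := p + 1) (q := q) (by push_cast; linarith) (by push_cast; linarith) (.inr hq),
      ladder_eq (p := p + 1) (q := q + 1) (by push_cast; linarith) (by push_cast; linarith)
        (.inl (by linarith))]
    field_simp
    rw [Real.sq_sqrt hq, Real.sq_sqrt (by linarith)]
  · push_cast at ha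
    rw [cg_lower_one_eq (p := p + 1) (by linarith), cg_lower_zero_eq (p := q) (by linarith),
      cg_lower_one_eq (p := p) (by push_cast; linarith),
      ladder_eq (p := p + 1) (q := q) (by push_cast; linarith) (by push_cast; linarith) (.inr hq),
      ladder_eq (p := p) (q := q) (by push_cast; linarith) (by push_cast; linarith) (.inl hp)]
    field_simp
    rw [Real.sq_sqrt hp, Real.sq_sqrt (by linarith)]
    ring

/-- To compare multiples of a Schur state one may assume that its `Z`-spin is possible. -/
theorem smul_schurAmp_congr {n : ℕ} {t : Fin (n + 1) → ℕ} (ht : IsSpinPath t) {z : ℤ} {c d : ℝ}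
    (h : IsZSpin (t (Fin.last n)) z → c = d) :
    (c : ℂ) • schurAmp n t z = (d : ℂ) • schurAmp n t z := by
  by_cases hz : IsZSpin (t (Fin.last n)) z
  · rw [h hz]
  · rw [schurAmp_eq_zero ht hz, smul_zero, smul_zero]

/-- In the induction the operator is S₊ on the shorter state plus |0⟩⟨1| on the new qubit. Comparing
the components along |0⟩ and |1⟩ leaves exactly `raise_cg_zero` and `raise_cg_one`. Both require the
resulting shorter state to have a possible `Z`-spin, and otherwise that state vanishes. -/
theorem raise_mulVec_schurAmp {n : ℕ} {t : Fin (n + 1) → ℕ} (ht : IsSpinPath t) (z : ℤ) :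
    collective n raiseMat *ᵥ schurAmp n t z =
      (ladder (t (Fin.last n)) z : ℂ) • schurAmp n t (z + 2) := by
  induction n generalizing z with
  | zero =>
    have h0 : t (Fin.last 0) = 0 := ht.1
    ext x
    rcases eq_or_ne (z + 2) 0 with h | h
    · obtain rfl : z = -2 := by omega
      rw [h0]
      simp [schurAmp, collective, ladder]
    · simp [schurAmp, collective, h]
  | succ n ih =>
    have h0 := smul_schurAmp_congr ht.init (raise_cg_zero ht.step_last (z := z))
    have h1 := smul_schurAmp_congr ht.init (raise_cg_one ht.step_last (z := z))
    rw [schurAmp_succ, schurAmp_succ]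
    simp only [Fin.sum_univ_two, mulVec_add, mulVec_smul, collective_mulVec_snocQubit,
      ih ht.init, map_smul, bitZ_zero, bitZ_one]
    simp only [raiseMat, of_apply, cons_val_zero, cons_val_one, cons_val', cons_val_fin_one,
      zero_smul, one_smul, add_zero, sub_neg_eq_add]
    rw [show z - 1 + 2 = z + 1 by ring, show z + 2 - 1 = z + 1 by ring,
      show z + 1 + 2 = z + 3 by ring, show z + 2 + 1 = z + 3 by ring]
    have h0' := congrArg (snocQubit 0) h0
    have h1' := congrArg (snocQubit 1) h1
    simp only [map_smul, Complex.ofReal_add, Complex.ofReal_mul] at h0' h1'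
    linear_combination (norm := module) h0' + h1'

theorem lower_mulVec_schurAmp {n : ℕ} {t : Fin (n + 1) → ℕ} (ht : IsSpinPath t) (z : ℤ) :
    collective n lowerMat *ᵥ schurAmp n t z =
      (ladder (t (Fin.last n)) (z - 2) : ℂ) • schurAmp n t (z - 2) := by
  induction n generalizing z with
  | zero =>
    have h0 : t (Fin.last 0) = 0 := ht.1
    ext x
    rcases eq_or_ne (z - 2) 0 with h | h
    · obtain rfl : z = 2 := by omega
      rw [h0]
      simp [schurAmp, collective, ladder]
    · simp [schurAmp, collective, h]
  | succ n ih =>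
    have h0 := smul_schurAmp_congr ht.init (lower_cg_zero ht.step_last (z := z))
    have h1 := smul_schurAmp_congr ht.init (lower_cg_one ht.step_last (z := z))
    rw [schurAmp_succ, schurAmp_succ]
    simp only [Fin.sum_univ_two, mulVec_add, mulVec_smul, collective_mulVec_snocQubit,
      ih ht.init, map_smul, bitZ_zero, bitZ_one]
    simp only [lowerMat, of_apply, cons_val_zero, cons_val_one, cons_val', cons_val_fin_one,
      zero_smul, one_smul, add_zero, zero_add, sub_neg_eq_add]
    rw [show z - 1 - 2 = z - 3 by ring, show z - 2 - 1 = z - 3 by ring,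
      show z + 1 - 2 = z - 1 by ring, show z - 2 + 1 = z - 1 by ring]
    have h0' := congrArg (snocQubit 0) h0
    have h1' := congrArg (snocQubit 1) h1
    simp only [map_smul, Complex.ofReal_add, Complex.ofReal_mul] at h0' h1'
    linear_combination (norm := module) h0' + h1'

theorem ladder_mul_self {a : ℕ} {z : ℤ} (hz : IsZSpin a z) :
    ladder a z * ladder a z = (a - z) * (a + z + 2) / 4 := by
  obtain ⟨p, q, hp, hq, ha, hz⟩ := hz.exists_real
  rw [ladder, ha, hz, div_mul_div_comm, Real.mul_self_sqrt]
  · norm_num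
  · have h1 : p + q - (p - q) = 2 * q := by ring
    have h2 : p + q + (p - q) + 2 = 2 * p + 2 := by ring
    rw [h1, h2]; positivity

theorem ladder_sub_mul_self {a : ℕ} {z : ℤ} (hz : IsZSpin a z) :
    ladder a (z - 2) * ladder a (z - 2) = (a - z + 2) * (a + z) / 4 := by
  obtain ⟨p, q, hp, hq, ha, hz⟩ := hz.exists_real
  rw [ladder, ha]
  push_cast
  rw [hz, div_mul_div_comm, Real.mul_self_sqrt]
  · ring
  · have h1 : p + q - (p - q - 2) = 2 * q + 2 := by ring
    have h2 : p + q + (p - q - 2) + 2 = 2 * p := by ring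
    rw [h1, h2]; positivity

/-- The computation is ½[(j - m)(j + m + 1) + (j - m + 1)(j + m)] + m² = j(j + 1). -/
theorem spinSq_univ_mulVec_schurAmp {n : ℕ} {t : Fin (n + 1) → ℕ} (ht : IsSpinPath t) (z : ℤ) :
    spinSq Finset.univ *ᵥ schurAmp n t z = casimir (t (Fin.last n)) • schurAmp n t z := by
  by_cases hz : IsZSpin (t (Fin.last n)) z
  · have h1 : ((ladder (t (Fin.last n)) z * ladder (t (Fin.last n)) z : ℝ) : ℂ) = _ :=
      congrArg _ (ladder_mul_self hz)
    have h2 : ((ladder (t (Fin.last n)) (z - 2) * ladder (t (Fin.last n)) (z - 2) : ℝ) : ℂ) = _ :=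
      congrArg _ (ladder_sub_mul_self hz)
    push_cast at h1 h2
    simp only [spinSq_univ, add_mulVec, smul_mulVec, ← mulVec_mulVec, raise_mulVec_schurAmp ht,
      lower_mulVec_schurAmp ht, spinZ_mulVec_schurAmp, mulVec_smul, sub_add_cancel,
      add_sub_cancel_right, smul_smul, h1, h2, casimir]
    module
  · rw [schurAmp_eq_zero ht hz]; simp

theorem spinSq_firstQubits_mulVec_schurAmp {n : ℕ} {t : Fin (n + 1) → ℕ} (ht : IsSpinPath t)
    (z : ℤ) (r : Fin (n + 1)) :
    spinSq (firstQubits n r) *ᵥ schurAmp n t z = casimir (t r) • schurAmp n t z := by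
  induction n generalizing z with
  | zero =>
    obtain rfl : r = Fin.last 0 := Fin.ext (by omega)
    exact (firstQubits_self 0) ▸ spinSq_univ_mulVec_schurAmp ht z
  | succ n ih =>
    induction r using Fin.lastCases with
    | last => rw [Fin.val_last, firstQubits_self]; exact spinSq_univ_mulVec_schurAmp ht z
    | cast r =>
      rw [schurAmp_succ]
      simp only [mulVec_sum, mulVec_smul, Finset.smul_sum]
      refine Finset.sum_congr rfl fun b _ => ?_
      rw [Fin.val_castSucc, spinSq_firstQubits_mulVec_snocQubit (Nat.lt_succ_iff.1 r.2),
        ih ht.init, map_smul, smul_comm]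

/-! ### Orthonormality -/

theorem star_snocQubit_dotProduct {n : ℕ} (b c : Fin 2) (u v : (Fin n → Fin 2) → ℂ) :
    star (snocQubit b u) ⬝ᵥ snocQubit c v = if b = c then star u ⬝ᵥ v else 0 := by
  simp only [dotProduct, Pi.star_apply, snocQubit_apply, sum_snoc, Fin.snoc_last,
    Fin.snoc_castSucc]
  split_ifs with h
  · subst h
    rw [Finset.sum_eq_single b]
    · simp
    · intro d _ hd; simp [hd]
    · simp
  · refine Finset.sum_eq_zero fun d _ => Finset.sum_eq_zero fun x _ => ?_
    by_cases hd : d = b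
    · subst hd; simp [h]
    · simp [hd]

/-- This happens only when the spin goes up and M = ±J is reached with the bit of the wrong sign. It
makes the `IsZSpin` condition on the shorter state harmless in the induction for orthonormality. -/
theorem cg_eq_zero {a a' : ℕ} (h : a' = a + 1 ∨ a' + 1 = a) {z : ℤ} {b : Fin 2}
    (hz : IsZSpin a' z) (hb : ¬ IsZSpin a (z - bitZ b)) : cg a a' z b = 0 := by
  obtain ⟨p, q, hpq, rfl⟩ := hz.exists_nat
  rcases h with rfl | rfl
  · have hb' : b = 0 ∧ p = 0 ∨ b = 1 ∧ q = 0 := by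
      by_contra hne
      refine hb ⟨?_, ?_⟩
      · rw [abs_le]; revert hne; fin_cases b <;> simp [bitZ] <;> omega
      · rw [Int.even_iff]; revert hne; fin_cases b <;> simp [bitZ] <;> omega
    rcases hb' with ⟨rfl, rfl⟩ | ⟨rfl, rfl⟩
    · rw [cg_raise_zero_eq (p := 0)]
      · simp
      · have : (q : ℝ) = a + 1 := by exact_mod_cast (by omega : q = a + 1)
        push_cast; linarith
    · rw [cg_raise_one_eq (p := 0)]
      · simp
      · have : (p : ℝ) = a + 1 := by exact_mod_cast (by omega : p = a + 1)
        push_cast; linarith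
  · exfalso
    refine hb ⟨?_, ?_⟩
    · rw [abs_le]; fin_cases b <;> simp [bitZ] <;> omega
    · rw [Int.even_iff]; fin_cases b <;> simp [bitZ] <;> omega

/-- Orthogonality of the Clebsch-Gordan coefficients for different total spins. -/
theorem sum_cg_mul_cg {a a' a'' : ℕ} (h' : a' = a + 1 ∨ a' + 1 = a) (h'' : a'' = a + 1 ∨ a'' + 1 = a)
    {z : ℤ} (hz' : IsZSpin a' z) (hz'' : IsZSpin a'' z) :
    ∑ b, cg a a' z b * cg a a'' z b = if a' = a'' then 1 else 0 := by
  obtain ⟨p, q, hp, hq, ha, hz⟩ := hz'.exists_real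
  obtain ⟨p', q', hp', hq', ha', hz'⟩ := hz''.exists_real
  rw [Fin.sum_univ_two]
  rcases h' with rfl | rfl
  · rcases h'' with rfl | rfl
    · push_cast at ha
      rw [if_pos rfl, cg_raise_zero_eq (p := p) (by linarith), cg_raise_one_eq (p := q) (by linarith)]
      rw [ha]
      have : 0 < p + q := by rw [← ha]; positivity
      simp only [div_mul_div_comm, Real.mul_self_sqrt, hp, hq, this.le]
      field_simp
    · push_cast at ha
      rw [if_neg (by omega), cg_raise_zero_eq (p := p) (by push_cast; linarith),
        cg_raise_one_eq (p := q) (by push_cast; linarith),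
        cg_lower_zero_eq (p := q) (by linarith), cg_lower_one_eq (p := p) (by linarith)]
      ring
  · rcases h'' with rfl | h
    · push_cast at ha'
      rw [if_neg (by omega), cg_raise_zero_eq (p := p') (by push_cast; linarith),
        cg_raise_one_eq (p := q') (by push_cast; linarith),
        cg_lower_zero_eq (p := q') (by linarith), cg_lower_one_eq (p := p') (by linarith)]
      ring
    · obtain rfl : a'' = a' := by omega
      rw [if_pos rfl, cg_lower_zero_eq (p := q + 1) (by linarith),
        cg_lower_one_eq (p := p + 1) (by linarith), ha]
      have h2 : 0 < p + q + 2 := by linarith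
      rw [neg_mul_neg]
      simp only [div_mul_div_comm, Real.mul_self_sqrt h2.le,
        Real.mul_self_sqrt (show 0 ≤ p + 1 by linarith),
        Real.mul_self_sqrt (show 0 ≤ q + 1 by linarith)]
      field_simp
      ring

-- Splitting off the last qubit gives a sum over its bit of products of coefficients times inner
-- products of shorter states. These force equal paths and equal `Z`-spins, and orthogonality of the
-- coefficients settles the last spin. Impossible `Z`-spins are admitted because the recursion
-- produces them.
open Classical in
theorem star_schurAmp_dotProduct {n : ℕ} {t t' : Fin (n + 1) → ℕ} (ht : IsSpinPath t)
    (ht' : IsSpinPath t') {z z' : ℤ} :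
    star (schurAmp n t z) ⬝ᵥ schurAmp n t' z' =
      if t = t' ∧ z = z' ∧ IsZSpin (t (Fin.last n)) z then 1 else 0 := by
  induction n generalizing z z' with
  | zero =>
    have htt : t = t' := by
      ext i
      obtain rfl : i = 0 := Fin.ext (by omega)
      rw [ht.1, ht'.1]
    subst htt
    have h0 : t (Fin.last 0) = 0 := ht.1
    have h1 : IsZSpin (t (Fin.last 0)) z ↔ z = 0 := by
      rw [h0]
      refine ⟨fun h => by simpa using h.1, ?_⟩
      rintro rfl; simp [IsZSpin]
    rw [h1]
    by_cases hz : z = 0 <;> by_cases hz' : z' = 0 <;> simp [dotProduct, schurAmp, hz, hz', eq_comm]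
  | succ n ih =>
    by_cases hz : IsZSpin (t (Fin.last (n + 1))) z
    swap
    · rw [schurAmp_eq_zero ht hz, if_neg (fun h => hz h.2.2)]; simp
    by_cases hz' : IsZSpin (t' (Fin.last (n + 1))) z'
    swap
    · rw [schurAmp_eq_zero ht' hz', dotProduct_zero, if_neg]
      rintro ⟨rfl, rfl, h⟩; exact hz' h
    have key : star (schurAmp (n + 1) t z) ⬝ᵥ schurAmp (n + 1) t' z' =
        ∑ b, ((cg (t (Fin.last n).castSucc) (t (Fin.last (n + 1))) z b *
          cg (t' (Fin.last n).castSucc) (t' (Fin.last (n + 1))) z' b : ℝ) : ℂ) *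
          (star (schurAmp n (fun r => t r.castSucc) (z - bitZ b)) ⬝ᵥ
            schurAmp n (fun r => t' r.castSucc) (z' - bitZ b)) := by
      rw [schurAmp_succ, schurAmp_succ]
      simp only [Fin.sum_univ_two, star_add, star_smul, add_dotProduct, dotProduct_add,
        smul_dotProduct, dotProduct_smul, star_snocQubit_dotProduct]
      simp
      ring
    rw [key]
    simp only [ih ht.init ht'.init]
    by_cases htt : (fun r : Fin (n + 1) => t r.castSucc) = fun r => t' r.castSucc
    swap
    · rw [if_neg (by rintro ⟨rfl, -⟩; exact htt rfl)]
      simp [htt]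
    by_cases hzz : z = z'
    swap
    · simp [hzz]
    subst hzz
    have ha : t' (Fin.last n).castSucc = t (Fin.last n).castSucc := (congrFun htt (Fin.last n)).symm
    have hstep := ht'.step_last
    rw [ha] at hstep ⊢
    have hsum := sum_cg_mul_cg ht.step_last hstep hz hz'
    have hiff : t = t' ↔ t (Fin.last (n + 1)) = t' (Fin.last (n + 1)) := by
      refine ⟨fun h => by rw [h], fun h => ?_⟩
      ext i
      induction i using Fin.lastCases with
      | last => exact h
      | cast i => exact congrFun htt i
    -- The indicator from the induction hypothesis can be dropped: where it is zero, so is the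
    -- coefficient.
    have : ∀ b, ((cg (t (Fin.last n).castSucc) (t (Fin.last (n + 1))) z b *
          cg (t (Fin.last n).castSucc) (t' (Fin.last (n + 1))) z b : ℝ) : ℂ) *
          (if (fun r : Fin (n + 1) => t r.castSucc) = (fun r => t' r.castSucc) ∧
            z - bitZ b = z - bitZ b ∧ IsZSpin (t (Fin.last n).castSucc) (z - bitZ b)
            then 1 else 0) = ((cg (t (Fin.last n).castSucc) (t (Fin.last (n + 1))) z b *
          cg (t (Fin.last n).castSucc) (t' (Fin.last (n + 1))) z b : ℝ) : ℂ) := by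
      intro b
      by_cases hb : IsZSpin (t (Fin.last n).castSucc) (z - bitZ b)
      · simp [htt, hb]
      · simp [cg_eq_zero ht.step_last hz hb]
    rw [Finset.sum_congr rfl fun b _ => this b, ← Complex.ofReal_sum, hsum]
    simp only [hiff, hz, and_true]
    split_ifs <;> simp

/-! ### Completeness -/

/-- Orthogonality of the Clebsch-Gordan coefficients for different `Z`-spins. -/
theorem sum_cg_mul_cg' (a : ℕ) {z : ℤ} (b c : Fin 2) (hzb : IsZSpin a (z - bitZ b)) :
    cg a (a + 1) z b * cg a (a + 1) z c + cg a (a - 1) z b * cg a (a - 1) z c =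
      if b = c then 1 else 0 := by
  obtain ⟨p, q, hp, hq, hs, hz⟩ : ∃ p q : ℝ, 0 ≤ p ∧ 0 ≤ q ∧ (a : ℝ) + 1 = p + q ∧
      (z : ℝ) = p - q := by
    obtain ⟨p, q, hp, hq, ha, hz⟩ := hzb.exists_real
    fin_cases b
    · exact ⟨p + 1, q, by linarith, hq, by rw [ha]; ring, by
        simp [bitZ] at hz; linarith⟩
    · exact ⟨p, q + 1, hp, by linarith, by rw [ha]; ring, by
        simp [bitZ] at hz; linarith⟩
  have h1 : cg a (a + 1) z 0 = √p / √(a + 1) := cg_raise_zero_eq (by linarith)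
  have h2 : cg a (a + 1) z 1 = √q / √(a + 1) := cg_raise_one_eq (by linarith)
  have hpq : 0 < p + q := by rw [← hs]; positivity
  -- For spin 0 the truncated `a - 1` is 0 again, which is no neighbouring spin, so that `cg` takes
  -- its default value 0. The coupling to spin 1/2 alone gives the Kronecker delta, because `z` is
  -- then determined by `b`.
  rcases a with _ | a
  · have h3 : ∀ b, cg 0 (0 - 1) z b = 0 := fun b => by simp [cg]
    have hb : z = bitZ b := by
      have : z - bitZ b = 0 := by simpa using hzb.1
      omega
    subst hb
    rw [h3, h3, mul_zero, add_zero]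
    clear h3
    generalize cg 0 (0 + 1) (bitZ b) = f at h1 h2 ⊢
    simp only [Nat.cast_zero, zero_add, Real.sqrt_one, div_one] at h1 h2 hs
    revert h1 h2 hz
    fin_cases b
    · intro hz h1 h2
      simp [bitZ] at hz
      obtain rfl : p = 1 := by linarith
      obtain rfl : q = 0 := by linarith
      fin_cases c <;> simp [h1, h2]
    · intro hz h1 h2
      simp [bitZ] at hz
      obtain rfl : p = 0 := by linarith
      obtain rfl : q = 1 := by linarith
      fin_cases c <;> simp [h1, h2]
  · have h3 : cg (a + 1) a z 0 = -(√q / √(a + 2)) := cg_lower_zero_eq (by push_cast at hs; linarith)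
    have h4 : cg (a + 1) a z 1 = √p / √(a + 2) := cg_lower_one_eq (by push_cast at hs; linarith)
    have e : (a : ℝ) + 2 = p + q := by push_cast at hs; linarith
    rw [hs] at h1 h2
    rw [e] at h3 h4
    rw [Nat.add_sub_cancel]
    fin_cases b <;> fin_cases c <;>
      simp [h1, h2, h3, h4, div_mul_div_comm, Real.mul_self_sqrt, hp, hq, hpq.le] <;>
      field_simp <;> ring

/-- This inverts the coupling recursion by means of `sum_cg_mul_cg'`. It yields completeness by
induction: if the φ span, the products φ ⊗ |b⟩ do too. -/
theorem snocQubit_schurAmp {n : ℕ} {t : Fin (n + 1) → ℕ} {z : ℤ}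
    (hz : IsZSpin (t (Fin.last n)) z) (b : Fin 2) :
    snocQubit b (schurAmp n t z) =
      (cg (t (Fin.last n)) (t (Fin.last n) + 1) (z + bitZ b) b : ℂ) •
        schurAmp (n + 1) (Fin.snoc (α := fun _ => ℕ) t (t (Fin.last n) + 1)) (z + bitZ b) +
      (cg (t (Fin.last n)) (t (Fin.last n) - 1) (z + bitZ b) b : ℂ) •
        schurAmp (n + 1) (Fin.snoc (α := fun _ => ℕ) t (t (Fin.last n) - 1)) (z + bitZ b) := by
  have h : ∀ c, ((_ : ℝ) : ℂ) = ((_ : ℝ) : ℂ) := fun c =>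
    congrArg Complex.ofReal (sum_cg_mul_cg' (t (Fin.last n)) (z := z + bitZ b) b c (by simpa using hz))
  have hb : snocQubit b (schurAmp n t z) = ∑ c, ((if b = c then 1 else 0 : ℝ) : ℂ) •
      snocQubit c (schurAmp n t (z + bitZ b - bitZ c)) := by
    rw [Finset.sum_eq_single b]
    · simp
    · intro c _ hc; simp [hc.symm]
    · simp
  rw [hb, schurAmp_succ, schurAmp_succ, Finset.smul_sum, Finset.smul_sum, ← Finset.sum_add_distrib]
  refine Finset.sum_congr rfl fun c _ => ?_
  rw [← h c]
  simp only [Fin.snoc_castSucc, Fin.snoc_last]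
  push_cast
  module

theorem span_schurAmp (n : ℕ) :
    Submodule.span ℂ (Set.range fun l : SchurLabel n => schurAmp n l.spin l.zspin) = ⊤ := by
  induction n with
  | zero =>
    rw [eq_top_iff]
    intro v _
    have : v = v 0 • schurAmp 0 (fun _ => 0) 0 := by
      ext x
      obtain rfl : x = 0 := Subsingleton.elim _ _
      simp [schurAmp]
    rw [this]
    exact Submodule.smul_mem _ _ (Submodule.subset_span
      ⟨⟨fun _ => 0, 0, rfl, fun i => i.elim0, by simp, by simp⟩, rfl⟩)
  | succ n ih =>
    rw [eq_top_iff]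
    intro v _
    rw [eq_sum_snocQubit v]
    refine Submodule.sum_mem _ fun b _ => ?_
    generalize (fun x => v (Fin.snoc (α := fun _ => Fin 2) x b)) = w
    have hw : w ∈ Submodule.span ℂ (Set.range fun l : SchurLabel n => schurAmp n l.spin l.zspin) :=
      ih ▸ Submodule.mem_top
    induction hw using Submodule.span_induction with
    | zero => simp
    | add u v _ _ hu hv => rw [map_add]; exact Submodule.add_mem _ hu hv
    | smul c u _ hu => rw [map_smul]; exact Submodule.smul_mem _ _ hu
    | mem u hu =>
      obtain ⟨l, rfl⟩ := hu
      have key : ∀ a, a = l.spin (Fin.last n) + 1 ∨ a + 1 = l.spin (Fin.last n) → ∀ z,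
          schurAmp (n + 1) (Fin.snoc (α := fun _ => ℕ) l.spin a) z ∈ Submodule.span ℂ
            (Set.range fun l : SchurLabel (n + 1) => schurAmp (n + 1) l.spin l.zspin) := by
        intro a ha z
        have hp := l.isSpinPath.snoc ha
        by_cases hz : IsZSpin ((Fin.snoc (α := fun _ => ℕ) l.spin a : Fin (n + 2) → ℕ)
            (Fin.last (n + 1))) z
        · exact Submodule.subset_span ⟨⟨_, z, hp.1, hp.2, hz.1, hz.2⟩, rfl⟩
        · rw [schurAmp_eq_zero hp hz]; exact Submodule.zero_mem _
      dsimp only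
      rw [snocQubit_schurAmp l.isZSpin]
      refine Submodule.add_mem _ (Submodule.smul_mem _ _ (key _ (.inl rfl) _)) ?_
      rcases Nat.eq_zero_or_pos (l.spin (Fin.last n)) with h | h
      · simp [h, cg]
      · exact Submodule.smul_mem _ _ (key _ (.inr (by omega)) _)

/-! ### The Schur basis in the Hilbert space -/

/-- The amplitudes of the Schur state of a label. -/
def SchurLabel.amp {n : ℕ} (l : SchurLabel n) : (Fin n → Fin 2) → ℂ := schurAmp n l.spin l.zspin

theorem SchurLabel.state_eq {n : ℕ} (l : SchurLabel n) : l.state = WithLp.toLp 2 l.amp := rfl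

open Classical in
theorem SchurLabel.star_amp_dotProduct {n : ℕ} (l l' : SchurLabel n) :
    star l.amp ⬝ᵥ l'.amp = if l = l' then 1 else 0 := by
  rw [SchurLabel.amp, SchurLabel.amp, star_schurAmp_dotProduct l.isSpinPath l'.isSpinPath]
  have : l = l' ↔ l.spin = l'.spin ∧ l.zspin = l'.zspin :=
    ⟨fun h => by rw [h]; exact ⟨rfl, rfl⟩, fun h => SchurLabel.ext h.1 h.2⟩
  have hz : IsZSpin (l.spin (Fin.last n)) l.zspin := l.isZSpin
  simp only [this, hz, and_true]

theorem inner_toLp_eq {n : ℕ} (u v : (Fin n → Fin 2) → ℂ) :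
    inner ℂ (WithLp.toLp 2 u : Qubits n) (WithLp.toLp 2 v) = star u ⬝ᵥ v := by
  rw [EuclideanSpace.inner_toLp_toLp, dotProduct_comm]

theorem SchurLabel.orthonormal_state (n : ℕ) :
    Orthonormal ℂ (SchurLabel.state : SchurLabel n → Qubits n) := by
  classical
  rw [orthonormal_iff_ite]
  intro l l'
  rw [l.state_eq, l'.state_eq, inner_toLp_eq, SchurLabel.star_amp_dotProduct]

theorem SchurLabel.span_state (n : ℕ) :
    Submodule.span ℂ (Set.range (SchurLabel.state : SchurLabel n → Qubits n)) = ⊤ := by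
  have h := congrArg (Submodule.map (WithLp.linearEquiv 2 ℂ ((Fin n → Fin 2) → ℂ)).symm.toLinearMap)
    (span_schurAmp n)
  rw [Submodule.map_span, ← Set.range_comp, Submodule.map_top, LinearEquiv.range] at h
  exact h

open ComplexOrder in
/-- A vector is determined by its inner products with the Schur states. -/
theorem ext_of_schur {n : ℕ} {u v : (Fin n → Fin 2) → ℂ}
    (h : ∀ l : SchurLabel n, star l.amp ⬝ᵥ u = star l.amp ⬝ᵥ v) : u = v := by
  rw [← sub_eq_zero]
  have key : ∀ w : (Fin n → Fin 2) → ℂ, star w ⬝ᵥ (u - v) = 0 := by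
    intro w
    have hw : w ∈ Submodule.span ℂ (Set.range fun l : SchurLabel n => schurAmp n l.spin l.zspin) :=
      span_schurAmp n ▸ Submodule.mem_top
    induction hw using Submodule.span_induction with
    | zero => simp
    | add a b _ _ ha hb => rw [star_add, add_dotProduct, ha, hb, add_zero]
    | smul c a _ ha => rw [star_smul, smul_dotProduct, ha, smul_zero]
    | mem a ha =>
      obtain ⟨l, rfl⟩ := ha
      rw [dotProduct_sub, sub_eq_zero]; exact h l
  exact dotProduct_star_self_eq_zero.1 (key (u - v))

theorem hasEigenvector_iff {n : ℕ} (A : Op n) (c : ℂ) (v : (Fin n → Fin 2) → ℂ) :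
    Module.End.HasEigenvector A.toEnd c (WithLp.toLp 2 v : Qubits n) ↔ A *ᵥ v = c • v ∧ v ≠ 0 := by
  rw [Module.End.hasEigenvector_iff, Module.End.mem_eigenspace_iff]
  refine and_congr ?_ ?_
  · rw [Op.toEnd, Matrix.toLpLin_toLp, ← WithLp.toLp_smul]
    exact (WithLp.toLp_injective 2).eq_iff
  · simp

theorem SchurLabel.amp_ne_zero {n : ℕ} (l : SchurLabel n) : l.amp ≠ 0 := by
  classical
  intro h
  have := l.star_amp_dotProduct l
  simp [h] at this

theorem SchurLabel.spinSq_mulVec_amp {n : ℕ} (l : SchurLabel n) :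
    spinSq Finset.univ *ᵥ l.amp = casimir l.total • l.amp :=
  spinSq_univ_mulVec_schurAmp l.isSpinPath l.zspin

/-! ### The operator `Θ̃` -/

theorem pauli_isHermitian (c : Fin 3) : (pauli c).IsHermitian := by
  ext i j
  fin_cases c <;> fin_cases i <;> fin_cases j <;> simp [pauli]

theorem onQubit_isHermitian {n : ℕ} {A : Matrix (Fin 2) (Fin 2) ℂ} (hA : A.IsHermitian)
    (i : Fin n) : (onQubit A i).IsHermitian := by
  ext x y
  simp only [conjTranspose_apply, onQubit]
  have : (∀ k, k ≠ i → y k = x k) ↔ ∀ k, k ≠ i → x k = y k :=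
    forall₂_congr fun k _ => eq_comm
  simp only [this]
  split_ifs
  · exact hA.apply _ _
  · simp

theorem angMom_isHermitian {n : ℕ} (a : Finset (Fin n)) (c : Fin 3) :
    (angMom a c).IsHermitian := by
  rw [IsHermitian, angMom, conjTranspose_sum]
  refine Finset.sum_congr rfl fun i _ => ?_
  rw [conjTranspose_smul, (onQubit_isHermitian (pauli_isHermitian c) i).eq]
  simp

theorem spinSq_isHermitian {n : ℕ} (a : Finset (Fin n)) : (spinSq a).IsHermitian := by
  rw [IsHermitian, spinSq, conjTranspose_sum]
  simp only [conjTranspose_mul, (angMom_isHermitian a _).eq]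

theorem casimir_injective : Function.Injective casimir := by
  intro d e h
  have h' : (((d * d + 2 * d : ℕ)) : ℂ) = ((e * e + 2 * e : ℕ) : ℂ) := by
    push_cast; simp only [casimir] at h; linear_combination 4 * h
  have h'' : d * d + 2 * d = e * e + 2 * e := by exact_mod_cast h'
  nlinarith [lt_trichotomy d e]

theorem spinProj_mulVec {n : ℕ} (d : ℕ) (w : (Fin n → Fin 2) → ℂ) :
    WithLp.toLp 2 (spinProj n d *ᵥ w) =
      (Module.End.eigenspace (spinSq (Finset.univ : Finset (Fin n))).toEnd
        (casimir d)).starProjection (WithLp.toLp 2 w) := by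
  change Matrix.toEuclideanLin (spinProj n d) (WithLp.toLp 2 w) = _
  rw [spinProj]
  exact congrArg (fun f : Qubits n →ₗ[ℂ] Qubits n => f (WithLp.toLp 2 w))
    (LinearEquiv.apply_symm_apply Matrix.toEuclideanLin _)

theorem toLp_mem_eigenspace {n : ℕ} {A : Op n} {c : ℂ} {w : (Fin n → Fin 2) → ℂ}
    (h : A *ᵥ w = c • w) :
    (WithLp.toLp 2 w : Qubits n) ∈ Module.End.eigenspace A.toEnd c := by
  rw [Module.End.mem_eigenspace_iff, Op.toEnd, Matrix.toLpLin_toLp, toLin'_apply, h,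
    WithLp.toLp_smul]

/-- S² is Hermitian and distinct spins have distinct Casimir values, so the other eigenspaces are
orthogonal to `w`. -/
theorem spinProj_mulVec_of_spinSq {n d : ℕ} {w : (Fin n → Fin 2) → ℂ}
    (h : spinSq Finset.univ *ᵥ w = casimir d • w) (e : ℕ) :
    spinProj n e *ᵥ w = if e = d then w else 0 := by
  apply WithLp.toLp_injective 2
  rw [spinProj_mulVec]
  have hw := toLp_mem_eigenspace h
  split_ifs with hd
  · subst hd
    exact Submodule.starProjection_eq_self_iff.2 hw
  · rw [WithLp.toLp_zero, Submodule.starProjection_apply_eq_zero_iff]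
    have hs : (spinSq (Finset.univ : Finset (Fin n))).toEnd.IsSymmetric :=
      Matrix.isSymmetric_toEuclideanLin_iff.2 (spinSq_isHermitian _)
    rw [Submodule.mem_orthogonal]
    intro u hu
    exact hs.orthogonalFamily_eigenspaces (casimir_injective.ne hd) ⟨u, hu⟩ ⟨_, hw⟩

/-- The eigenvalue `σ(s) = 4 / (N + 3 + 2 s)` for `N = n + 1` and `s = d / 2`. -/
def sigmaVal (n d : ℕ) : ℂ := 4 / ((n : ℂ) + 1 + 3 + d)

/-- Indeed λ⁺_{s+1/2} = 2^{-N}(N + 3 + 2s)/2, and 2^{-(N-1)} · 2^N · 2 = 4. -/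
theorem theta_coeff (n d : ℕ) :
    (1 / 2 ^ n : ℂ) * ((1 / lambdaPlus (n + 1) ((d : ℝ) / 2 + 1 / 2) : ℝ) : ℂ) = sigmaVal n d := by
  have h : (n : ℂ) + 1 + 3 + d ≠ 0 := by
    have : ((n + 1 + 3 + d : ℕ) : ℂ) ≠ 0 := Nat.cast_ne_zero.2 (by omega)
    push_cast at this
    exact this
  have e : ((n : ℂ) + 1) / 2 + (d / 2 + 1 / 2) + 1 = (n + 1 + 3 + d) / 2 := by ring
  rw [lambdaPlus, sigmaVal]
  push_cast
  rw [e, pow_succ]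
  field_simp
  norm_num

theorem IsSpinPath.le_and_parity {n : ℕ} {t : Fin (n + 1) → ℕ} (ht : IsSpinPath t) :
    t (Fin.last n) ≤ n ∧ t (Fin.last n) % 2 = n % 2 := by
  induction n with
  | zero => have : t (Fin.last 0) = 0 := ht.1; omega
  | succ n ih =>
    have h1 := ih ht.init
    have h2 := ht.step_last
    omega

theorem star_dotProduct_mulVec_of_isHermitian {n : ℕ} {A : Op n} (hA : A.IsHermitian)
    (u v : (Fin n → Fin 2) → ℂ) : star u ⬝ᵥ (A *ᵥ v) = star (A *ᵥ u) ⬝ᵥ v := by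
  rw [star_mulVec, hA.eq, dotProduct_mulVec]

theorem theta_mulVec_of_spinSq {n d : ℕ} {w : (Fin n → Fin 2) → ℂ}
    (h : spinSq Finset.univ *ᵥ w = casimir d • w) : theta n *ᵥ w = sigmaVal n d • w := by
  by_cases hd : d ∈ (Finset.range (n + 1)).filter (fun d => d % 2 = n % 2)
  · simp only [theta, smul_mulVec, sum_mulVec, spinProj_mulVec_of_spinSq h]
    rw [Finset.sum_eq_single_of_mem d hd (fun e _ he => by rw [if_neg he, smul_zero]), if_pos rfl,
      smul_smul, theta_coeff]
  -- A spin missing from the sum does not occur on `n` qubits: all Schur states have other Casimir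
  -- values, so `w` is orthogonal to each of them.
  · obtain rfl : w = 0 := by
      refine ext_of_schur fun l => ?_
      rw [dotProduct_zero]
      have h1 := star_dotProduct_mulVec_of_isHermitian (spinSq_isHermitian Finset.univ) l.amp w
      rw [h, l.spinSq_mulVec_amp, star_smul, smul_dotProduct, dotProduct_smul] at h1
      have h2 : star (casimir l.total) = casimir l.total := by simp [casimir]
      rw [h2, smul_eq_mul, smul_eq_mul] at h1
      have h3 : l.total ≠ d := by
        rintro rfl
        have := l.isSpinPath.le_and_parity
        apply hd
        simp only [Finset.mem_filter, Finset.mem_range]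
        exact ⟨Nat.lt_succ_of_le this.1, this.2⟩
      exact (mul_eq_mul_right_iff.1 h1).resolve_left (casimir_injective.ne h3.symm)
    simp

/-! ### Contraction with the singlet -/

/-- The vector `w ⊗ |ψ⁻⟩`. -/
def singletExt {n : ℕ} : ((Fin n → Fin 2) → ℂ) →ₗ[ℂ] ((Fin (n + 2) → Fin 2) → ℂ) :=
  ∑ b, ∑ c, singlet b c • (snocQubit c ∘ₗ snocQubit b)

theorem singletExt_eq {n : ℕ} (w : (Fin n → Fin 2) → ℂ) :
    singletExt w = ∑ b, ∑ c, singlet b c • snocQubit c (snocQubit b w) := by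
  simp [singletExt]

theorem singletExt_apply {n : ℕ} (w : (Fin n → Fin 2) → ℂ) (x : Fin (n + 2) → Fin 2) :
    singletExt w x = singlet (x (Fin.last n).castSucc) (x (Fin.last (n + 1))) *
      w (fun i => x i.castSucc.castSucc) := by
  simp only [singletExt_eq, Finset.sum_apply, Pi.smul_apply, snocQubit_apply, smul_eq_mul, mul_ite,
    mul_zero, Finset.sum_ite_eq, Finset.mem_univ, if_true]

/-- The vector `⟨ψ⁻| v`, for the singlet of the last two qubits. -/
def singletContract {n : ℕ} (v : (Fin (n + 2) → Fin 2) → ℂ) : (Fin n → Fin 2) → ℂ :=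
  fun x => ∑ c, ∑ b, star (singlet b c) *
    v (Fin.snoc (α := fun _ => Fin 2) (Fin.snoc (α := fun _ => Fin 2) x b) c)

theorem star_singletExt_dotProduct {n : ℕ} (w : (Fin n → Fin 2) → ℂ)
    (v : (Fin (n + 2) → Fin 2) → ℂ) :
    star (singletExt w) ⬝ᵥ v = star w ⬝ᵥ singletContract v := by
  simp only [dotProduct, Pi.star_apply, singletExt_apply, sum_snoc, singletContract, Fin.snoc_last,
    Fin.snoc_castSucc, Finset.mul_sum]
  rw [Finset.sum_comm]
  simp only [Fin.sum_univ_two, Finset.sum_add_distrib, star_mul']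
  simp only [← Finset.sum_add_distrib]
  refine Finset.sum_congr rfl fun x _ => ?_
  ring

/-- This is the factorization Π_N = E Θ̃ E†; `star_singletExt_dotProduct` and
`singletContract_singletExt` say that contraction is the adjoint of E and that E is an isometry. -/
theorem povm_last_mulVec {n : ℕ} (v : (Fin (n + 2) → Fin 2) → ℂ) :
    povm (Fin.last n) *ᵥ v = singletExt (theta n *ᵥ singletContract v) := by
  ext x
  rw [singletExt_apply]
  simp only [mulVec, dotProduct, povm, singletContract, sum_snoc, Fin.snoc_last,
    Fin.snoc_castSucc, Fin.succAbove_last, Finset.mul_sum]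
  rw [Finset.sum_comm]
  simp only [Fin.sum_univ_two, Finset.sum_add_distrib]
  simp only [← Finset.sum_add_distrib]
  refine Finset.sum_congr rfl fun x _ => ?_
  ring

theorem singletContract_singletExt {n : ℕ} (w : (Fin n → Fin 2) → ℂ) :
    singletContract (singletExt w) = w := by
  ext x
  have h2 : ((√2 : ℝ) : ℂ) * ((√2 : ℝ) : ℂ) = 2 := by
    rw [← Complex.ofReal_mul, Real.mul_self_sqrt (by norm_num)]; simp
  have h3 : ((√2 : ℝ) : ℂ) ≠ 0 := by
    intro h; rw [h] at h2; norm_num at h2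
  simp only [singletContract, singletExt_apply, Fin.snoc_last, Fin.snoc_castSucc]
  simp [Fin.sum_univ_two, singlet]
  field_simp
  linear_combination (-w x) * h2

theorem povm_last_mulVec_singletExt {n d : ℕ} {w : (Fin n → Fin 2) → ℂ}
    (h : spinSq Finset.univ *ᵥ w = casimir d • w) :
    povm (Fin.last n) *ᵥ singletExt w = sigmaVal n d • singletExt w := by
  rw [povm_last_mulVec, singletContract_singletExt, theta_mulVec_of_spinSq h, map_smul]

/-! ### The eigenvectors of `Π_N` -/

/-- The (real) amplitudes of the singlet. -/
def singletReal (b c : Fin 2) : ℝ :=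
  if b = 0 ∧ c = 1 then 1 / √2 else if b = 1 ∧ c = 0 then -(1 / √2) else 0

theorem ofReal_singletReal (b c : Fin 2) : (singletReal b c : ℂ) = singlet b c := by
  unfold singletReal singlet
  split_ifs <;> simp

theorem sqrt_sigma_lower (s : ℕ) :
    √((s : ℝ) / 2 / (2 * ((s : ℝ) / 2) + 1)) = √s / (√2 * √(s + 1)) := by
  rw [← Real.sqrt_mul (by norm_num), ← Real.sqrt_div (by positivity)]
  congr 1; field_simp

theorem sqrt_sigma_raise (s : ℕ) :
    √(((s : ℝ) / 2 + 1) / (2 * ((s : ℝ) / 2) + 1)) = √(s + 2) / (√2 * √(s + 1)) := by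
  rw [← Real.sqrt_mul (by norm_num), ← Real.sqrt_div (by positivity)]
  congr 1; field_simp

/-- The numbers `x` and `y` are the numerators of the two coefficients on the path s → s + ½ → s.
The weight is such that the denominators collapse. In `sigma_lower_mul`, for the path through s - ½,
the doubled spin is `s + 1`, so both paths end up with the same denominator. -/
theorem sigma_raise_mul (s : ℕ) (x y : ℝ) :
    √((s : ℝ) + 2) / (√2 * √(s + 1)) * (x / √(s + 2) * (y / √(s + 1))) =
      x * y / (√2 * (s + 1)) := by
  have h1 : √((s : ℝ) + 2) ≠ 0 := by positivity
  have h2 : √((s : ℝ) + 1) * √(s + 1) = s + 1 := Real.mul_self_sqrt (by positivity)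
  calc _ = x * y / (√2 * (√(s + 1) * √(s + 1))) := by field_simp
    _ = _ := by rw [h2]

theorem sigma_lower_mul (s : ℕ) (x y : ℝ) :
    √((s : ℝ) + 1) / (√2 * √(s + 2)) * (x / √(s + 1) * (y / √(s + 2))) =
      x * y / (√2 * (s + 2)) := by
  have h1 : √((s : ℝ) + 1) ≠ 0 := by positivity
  have h2 : √((s : ℝ) + 2) * √(s + 2) = s + 2 := Real.mul_self_sqrt (by positivity)
  calc _ = x * y / (√2 * (√(s + 2) * √(s + 2))) := by field_simp
    _ = _ := by rw [h2]

/-- Recoupling: the amplitudes of the singlet of the last two qubits, in terms of the two ways of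
coupling them to the first ones without changing the spin `s / 2`. -/
theorem recoupling (s : ℕ) (z : ℤ) (b c : Fin 2) (hz : IsZSpin s (z - bitZ c - bitZ b)) :
    √((s : ℝ) / 2 / (2 * ((s : ℝ) / 2) + 1)) *
        (cg (s - 1) s z c * cg s (s - 1) (z - bitZ c) b) -
      √(((s : ℝ) / 2 + 1) / (2 * ((s : ℝ) / 2) + 1)) *
        (cg (s + 1) s z c * cg s (s + 1) (z - bitZ c) b) = -singletReal b c := by
  obtain ⟨p, q, hp, hq, hs, hz⟩ := hz.exists_real
  have hs1 : (s : ℝ) + 1 ≠ 0 := by positivity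
  have h2 : √(2 : ℝ) ≠ 0 := by positivity
  have hmid : (p + (q + 1)) / (√2 * ((s : ℝ) + 1)) = 1 / √2 := by
    rw [div_eq_div_iff (by positivity) h2, hs]; ring
  have hp1 : √(p + 1) * √(p + 1) = p + 1 := Real.mul_self_sqrt (by linarith)
  have hq1 : √(q + 1) * √(q + 1) = q + 1 := Real.mul_self_sqrt (by linarith)
  have hpp : √p * √p = p := Real.mul_self_sqrt hp
  have hqq : √q * √q = q := Real.mul_self_sqrt hq
  rw [sqrt_sigma_lower, sqrt_sigma_raise]
  -- This includes spin 0, where `s - 1` is truncated but the weight √0 removes the term; the right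
  -- side must then vanish too, whence the condition on `x * y`.
  have hlow : ∀ x y : ℝ, (s = 0 → x * y = 0) →
      (∀ k : ℕ, s = k + 1 → cg k s z c = x / √(k + 1) ∧
        cg s k (z - bitZ c) b = y / √(k + 2)) →
      √(s : ℝ) / (√2 * √((s : ℝ) + 1)) *
        (cg (s - 1) s z c * cg s (s - 1) (z - bitZ c) b) = x * y / (√2 * (s + 1)) := by
    intro x y h0 h
    rcases s with _ | k
    · rw [h0 rfl]; simp
    · obtain ⟨h1, h2⟩ := h k rfl
      rw [Nat.add_sub_cancel, h1, h2]
      push_cast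
      rw [add_assoc, one_add_one_eq_two]
      exact sigma_lower_mul k x y
  have h00 : s = 0 → p = 0 ∧ q = 0 := by
    rintro rfl
    rw [Nat.cast_zero] at hs
    constructor <;> linarith
  -- For b = c the two paths cancel. For b ≠ c their numerators are, up to a common sign, p and q +
  -- 1 or q and p + 1, with sum s + 1 in doubled units, which cancels the denominator.
  fin_cases b <;> fin_cases c <;> simp [bitZ] at hz <;>
    simp only [Fin.zero_eta, Fin.mk_one, bitZ_zero, bitZ_one] at hlow ⊢
  · rw [hlow (√(p + 1)) (-√q) (fun h => by simp [h00 h]) (by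
      rintro k rfl
      push_cast at hs
      rw [cg_raise_zero_eq (p := p + 1) (by linarith),
        cg_lower_zero_eq (p := q) (by push_cast; linarith), neg_div]
      exact ⟨rfl, rfl⟩), cg_lower_zero_eq (p := q) (by linarith),
      cg_raise_zero_eq (p := p + 1) (by push_cast; linarith), ← neg_div, sigma_raise_mul]
    simp [singletReal]; ring
  · rw [hlow (√q) (-√q) (fun h => by simp [h00 h]) (by
      rintro k rfl
      push_cast at hs
      rw [cg_raise_one_eq (p := q) (by linarith),
        cg_lower_zero_eq (p := q) (by push_cast; linarith), neg_div]
      exact ⟨rfl, rfl⟩), cg_lower_one_eq (p := p + 1) (by linarith),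
      cg_raise_zero_eq (p := p + 1) (by push_cast; linarith), sigma_raise_mul]
    simp only [singletReal, and_self, if_true]
    rw [← hmid, hp1, mul_neg, hqq]; ring
  · rw [hlow (√p) (√p) (fun h => by simp [h00 h]) (by
      rintro k rfl
      push_cast at hs
      rw [cg_raise_zero_eq (p := p) (by linarith),
        cg_lower_one_eq (p := p) (by push_cast; linarith)]
      exact ⟨rfl, rfl⟩), cg_lower_zero_eq (p := q + 1) (by linarith),
      cg_raise_one_eq (p := q + 1) (by push_cast; linarith), ← neg_div, sigma_raise_mul]
    simp only [singletReal, and_self, one_ne_zero, false_and, if_true, if_false]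
    rw [← hmid, hpp, neg_mul, hq1]; ring
  · rw [hlow (√(q + 1)) (√p) (fun h => by simp [h00 h]) (by
      rintro k rfl
      push_cast at hs
      rw [cg_raise_one_eq (p := q + 1) (by linarith),
        cg_lower_one_eq (p := p) (by push_cast; linarith)]
      exact ⟨rfl, rfl⟩), cg_lower_one_eq (p := p) (by linarith),
      cg_raise_one_eq (p := q + 1) (by push_cast; linarith), sigma_raise_mul]
    simp [singletReal]; ring

/-- The amplitudes of the state `|k̃, s, j, s, m⟩`. -/
def SchurLabel.extendAmp {n : ℕ} (l : SchurLabel n) (a : ℕ) : (Fin (n + 2) → Fin 2) → ℂ :=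
  schurAmp (n + 2)
    (Fin.snoc (α := fun _ => ℕ) (Fin.snoc (α := fun _ => ℕ) l.spin a) l.total) l.zspin

theorem SchurLabel.extendAmp_eq {n : ℕ} (l : SchurLabel n) (a : ℕ) :
    l.extendAmp a = ∑ c, ∑ b,
      ((cg a l.total l.zspin c * cg l.total a (l.zspin - bitZ c) b : ℝ) : ℂ) •
        snocQubit c (snocQubit b (schurAmp n l.spin (l.zspin - bitZ c - bitZ b))) := by
  rw [extendAmp, schurAmp_succ]
  simp only [schurAmp_succ, Fin.snoc_last, Fin.snoc_castSucc, map_sum, map_smul, Finset.smul_sum,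
    smul_smul, Complex.ofReal_mul]
  rfl

/-- Both intermediate spins lead to the same shorter states in the amplitudes, so the combination
can be taken coefficient by coefficient with `recoupling`. -/
theorem SchurLabel.sigmaVec_eq {n : ℕ} (l : SchurLabel n) :
    l.sigmaVec = WithLp.toLp 2 (-singletExt l.amp) := by
  have hd : l.sigmaVec = WithLp.toLp 2
      (((√((l.total : ℝ) / 2 / (2 * ((l.total : ℝ) / 2) + 1)) : ℝ) : ℂ) • l.extendAmp (l.total - 1) -
      ((√(((l.total : ℝ) / 2 + 1) / (2 * ((l.total : ℝ) / 2) + 1)) : ℝ) : ℂ) •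
        l.extendAmp (l.total + 1)) := rfl
  rw [hd]
  congr 1
  rw [singletExt_eq, Finset.sum_comm]
  simp only [l.extendAmp_eq, Finset.smul_sum, ← Finset.sum_sub_distrib, ← Finset.sum_neg_distrib]
  refine Finset.sum_congr rfl fun c _ => Finset.sum_congr rfl fun b _ => ?_
  have h := smul_schurAmp_congr l.isSpinPath (recoupling l.total l.zspin b c)
  have h' := congrArg (fun v => snocQubit c (snocQubit b v)) h
  simp only [map_smul, Complex.ofReal_sub, Complex.ofReal_mul, Complex.ofReal_neg,
    ofReal_singletReal] at h'
  rw [smul_smul, smul_smul, ← sub_smul]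
  simp only [Complex.ofReal_mul]
  rw [h', neg_smul]
  congr 1
  -- The singlet has `Z`-spin 0: either the shift of the `Z`-spin cancels or the singlet amplitude
  -- is zero.
  by_cases hbc : bitZ c + bitZ b = 0
  · rw [show l.zspin - bitZ c - bitZ b = l.zspin by omega]; rfl
  · have : singlet b c = 0 := by
      revert hbc; fin_cases b <;> fin_cases c <;> simp [bitZ, singlet]
    rw [this, zero_smul, zero_smul]

theorem SchurLabel.hasEigenvector_sigmaVec {n : ℕ} (l : SchurLabel n) :
    Module.End.HasEigenvector (povm (Fin.last n)).toEnd (sigmaVal n l.total) l.sigmaVec := by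
  rw [l.sigmaVec_eq, hasEigenvector_iff]
  refine ⟨?_, fun h => ?_⟩
  · rw [mulVec_neg, povm_last_mulVec_singletExt l.spinSq_mulVec_amp, smul_neg]
  · apply l.amp_ne_zero
    rw [← singletContract_singletExt l.amp, neg_eq_zero.1 h]
    ext x
    simp [singletContract]

/-- By adjointness the hypothesis says that ⟨ψ⁻|v is orthogonal to every Schur state of the first
`n` qubits, so it is zero. -/
theorem povm_last_mulVec_eq_zero {n : ℕ} {v : (Fin (n + 2) → Fin 2) → ℂ}
    (h : ∀ l : SchurLabel n, inner ℂ l.sigmaVec (WithLp.toLp 2 v : Qubits (n + 2)) = 0) :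
    povm (Fin.last n) *ᵥ v = 0 := by
  have : singletContract v = 0 := by
    refine ext_of_schur fun l => ?_
    have := h l
    rw [l.sigmaVec_eq, inner_toLp_eq, star_neg, neg_dotProduct, star_singletExt_dotProduct,
      neg_eq_zero] at this
    rw [this, dotProduct_zero]
  rw [povm_last_mulVec, this, mulVec_zero, map_zero]

theorem SchurLabel.isSpinPath_extend {n : ℕ} (l : SchurLabel n) {a : ℕ}
    (ha : a = l.total + 1 ∨ a + 1 = l.total) :
    IsSpinPath (Fin.snoc (α := fun _ => ℕ) (Fin.snoc (α := fun _ => ℕ) l.spin a) l.total :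
      Fin (n + 3) → ℕ) :=
  (l.isSpinPath.snoc ha).snoc (by rw [Fin.snoc_last]; omega)

/-- The label `(k̃, s, j, s, m)`, for the label `(k̃, s, m)` and `j = a / 2`. -/
def SchurLabel.extendLabel {n : ℕ} (l : SchurLabel n) (a : ℕ)
    (ha : a = l.total + 1 ∨ a + 1 = l.total) : SchurLabel (n + 2) where
  spin := Fin.snoc (α := fun _ => ℕ) (Fin.snoc (α := fun _ => ℕ) l.spin a) l.total
  zspin := l.zspin
  spin_zero := (l.isSpinPath_extend ha).1
  spin_step := (l.isSpinPath_extend ha).2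
  zspin_le := by rw [Fin.snoc_last]; exact l.zspin_le
  zspin_parity := by rw [Fin.snoc_last]; exact l.zspin_parity

theorem SchurLabel.extend_eq_state {n : ℕ} (l : SchurLabel n) (a : ℕ)
    (ha : a = l.total + 1 ∨ a + 1 = l.total) : l.extend a = (l.extendLabel a ha).state := rfl

theorem SchurLabel.extendLabel_inj {n : ℕ} {l l' : SchurLabel n} {a a' : ℕ}
    {ha : a = l.total + 1 ∨ a + 1 = l.total} {ha' : a' = l'.total + 1 ∨ a' + 1 = l'.total}
    (h : l.extendLabel a ha = l'.extendLabel a' ha') : l = l' ∧ a = a' := by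
  have hs := congrArg SchurLabel.spin h
  have hz := congrArg SchurLabel.zspin h
  simp only [extendLabel] at hs
  obtain ⟨h1, -⟩ := Fin.snoc_injective2 hs
  obtain ⟨h2, h3⟩ := Fin.snoc_injective2 h1
  exact ⟨SchurLabel.ext h2 hz, h3⟩

/-- The inner product with `sigmaVec`. -/
theorem SchurLabel.inner_sigmaVec {n : ℕ} (l : SchurLabel n) (v : Qubits (n + 2)) :
    inner ℂ l.sigmaVec v =
      ((√((l.total : ℝ) / 2 / (2 * ((l.total : ℝ) / 2) + 1)) : ℝ) : ℂ) *
        inner ℂ (l.extend (l.total - 1)) v -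
      ((√(((l.total : ℝ) / 2 + 1) / (2 * ((l.total : ℝ) / 2) + 1)) : ℝ) : ℂ) *
        inner ℂ (l.extend (l.total + 1)) v := by
  simp only [sigmaVec, inner_sub_left, inner_smul_left, Complex.conj_ofReal]

theorem SchurLabel.inner_sigmaVec_state {n : ℕ} (l : SchurLabel n) {l' : SchurLabel (n + 2)}
    (h : l'.spin (Fin.last n).castSucc.castSucc ≠ l'.total) :
    inner ℂ l.sigmaVec l'.state = 0 := by
  have key : ∀ a (ha : a = l.total + 1 ∨ a + 1 = l.total),
      inner ℂ (l.extend a) l'.state = 0 := by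
    intro a ha
    rw [l.extend_eq_state a ha]
    refine (SchurLabel.orthonormal_state (n + 2)).2 ?_
    rintro rfl
    apply h
    simp only [extendLabel, Fin.snoc_castSucc, total, Fin.snoc_last]
  rw [l.inner_sigmaVec, key _ (.inl rfl)]
  -- For spin 0 the truncated label is not admissible, but its coefficient is √0.
  rcases Nat.eq_zero_or_pos l.total with h0 | h0
  · simp [h0]
  · rw [key _ (.inr (by omega))]; simp

/-- For equal labels the coefficient pairs (√α, -√β) and (√β, √α) are orthogonal; for different
labels all the Schur states involved are. -/
theorem SchurLabel.inner_sigmaVec_nullVec {n : ℕ} (l l' : SchurLabel n) (h' : l'.total ≠ 0) :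
    inner ℂ l.sigmaVec l'.nullVec = 0 := by
  classical
  have ho := orthonormal_iff_ite.1 (SchurLabel.orthonormal_state (n + 2))
  rw [l.inner_sigmaVec]
  simp only [nullVec, inner_add_right, inner_smul_right]
  have e1 : l'.total - 1 = l'.total + 1 ∨ l'.total - 1 + 1 = l'.total := .inr (by omega)
  have key : ∀ a (ha : a = l.total + 1 ∨ a + 1 = l.total) a'
      (ha' : a' = l'.total + 1 ∨ a' + 1 = l'.total),
      inner ℂ (l.extend a) (l'.extend a') = if l = l' ∧ a = a' then 1 else 0 := by
    intro a ha a' ha'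
    rw [l.extend_eq_state a ha, l'.extend_eq_state a' ha', ho]
    refine if_congr ⟨SchurLabel.extendLabel_inj, ?_⟩ rfl rfl
    rintro ⟨rfl, rfl⟩; rfl
  rcases Nat.eq_zero_or_pos l.total with h0 | h0
  · have hne : l ≠ l' := by rintro rfl; exact h' h0
    rw [key _ (.inl rfl) _ e1, key _ (.inl rfl) _ (.inl rfl)]
    simp [h0, hne]
  · have e2 : l.total - 1 = l.total + 1 ∨ l.total - 1 + 1 = l.total := .inr (by omega)
    rw [key _ (.inl rfl) _ e1, key _ (.inl rfl) _ (.inl rfl), key _ e2 _ e1, key _ e2 _ (.inl rfl)]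
    by_cases hl : l = l'
    · subst hl
      have hne : l.total + 1 ≠ l.total - 1 := by omega
      simp only [hne, hne.symm, and_self, and_false, if_true, if_false]
      ring
    · simp [hl]

theorem SchurLabel.nullVec_ne_zero {n : ℕ} (l : SchurLabel n) (h : l.total ≠ 0) :
    l.nullVec ≠ 0 := by
  classical
  intro h0
  have ho := orthonormal_iff_ite.1 (SchurLabel.orthonormal_state (n + 2))
  have h1 : inner ℂ (l.extend (l.total + 1)) l.nullVec = 0 := by rw [h0, inner_zero_right]
  simp only [nullVec, inner_add_right, inner_smul_right] at h1
  rw [l.extend_eq_state _ (.inl rfl), l.extend_eq_state (l.total - 1) (.inr (by omega)), ho, ho,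
    if_pos rfl, if_neg, mul_zero, zero_add, mul_one, Complex.ofReal_eq_zero] at h1
  · have : (0 : ℝ) < l.total := by exact_mod_cast Nat.pos_of_ne_zero h
    exact (Real.sqrt_pos.2 (by positivity)).ne' h1
  · intro h2
    have := (SchurLabel.extendLabel_inj h2).2
    omega

theorem hasEigenvector_povm_last_zero {n : ℕ} {v : Qubits (n + 2)} (hv : v ≠ 0)
    (h : ∀ l : SchurLabel n, inner ℂ l.sigmaVec v = 0) :
    Module.End.HasEigenvector (povm (Fin.last n)).toEnd 0 v := by
  have : v = WithLp.toLp 2 (WithLp.ofLp v) := rfl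
  rw [this, hasEigenvector_iff, zero_smul]
  refine ⟨povm_last_mulVec_eq_zero h, fun h0 => hv ?_⟩
  rw [this, h0, WithLp.toLp_zero]

/-! ### Permutations of the qubits -/

/-- The permutation `x ↦ x ∘ e` of the computational basis. -/
def permBasis {n : ℕ} (e : Equiv.Perm (Fin n)) : Equiv.Perm (Fin n → Fin 2) :=
  Equiv.arrowCongr e.symm (Equiv.refl _)

theorem permBasis_apply {n : ℕ} (e : Equiv.Perm (Fin n)) (x : Fin n → Fin 2) :
    permBasis e x = x ∘ e := by
  ext; simp [permBasis]

theorem onQubit_submatrix {n : ℕ} (A : Matrix (Fin 2) (Fin 2) ℂ) (i : Fin n)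
    (e : Equiv.Perm (Fin n)) :
    (onQubit A i).submatrix (permBasis e) (permBasis e) = onQubit A (e i) := by
  ext x y
  simp only [submatrix_apply, onQubit, permBasis_apply, Function.comp_apply]
  refine if_congr ⟨fun h k hk => ?_, fun h k hk => h _ (e.injective.ne hk)⟩ rfl rfl
  have := h (e.symm k) (fun h' => hk (by rw [← h', e.apply_symm_apply]))
  simpa using this

theorem spinSq_univ_submatrix {n : ℕ} (e : Equiv.Perm (Fin n)) :
    (spinSq Finset.univ).submatrix (permBasis e) (permBasis e) = spinSq (n := n) Finset.univ := by
  have h : ∀ c, (angMom Finset.univ c).submatrix (permBasis e) (permBasis e) =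
      angMom (n := n) Finset.univ c := by
    intro c
    ext x y
    simp only [angMom, submatrix_apply, Matrix.sum_apply, Matrix.smul_apply]
    rw [← Equiv.sum_comp e fun i => (1 / 2 : ℂ) • onQubit (pauli c) i x y]
    simp only [← onQubit_submatrix, submatrix_apply]
  have hs : ∀ A B : Op n, (A + B).submatrix (permBasis e) (permBasis e) =
    A.submatrix (permBasis e) (permBasis e) + B.submatrix (permBasis e) (permBasis e) :=
    fun _ _ => rfl
  simp only [spinSq, Fin.sum_univ_three, hs, ← submatrix_mul_equiv _ _ _ (permBasis e) _, h]

theorem submatrix_perm_mulVec {n : ℕ} (A : Op n) (e : Equiv.Perm (Fin n → Fin 2))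
    (v : (Fin n → Fin 2) → ℂ) : A.submatrix e e *ᵥ v = (A *ᵥ (v ∘ e.symm)) ∘ e :=
  submatrix_mulVec_equiv _ _ _ _

/-- A permuted Schur state still has the same spin, because S² is permutation invariant, and Θ̃ is a
scalar on each spin. -/
theorem theta_submatrix {n : ℕ} (e : Equiv.Perm (Fin n)) :
    (theta n).submatrix (permBasis e) (permBasis e) = theta n := by
  have hspan : ∀ A B : Op n, (∀ l : SchurLabel n, A *ᵥ l.amp = B *ᵥ l.amp) → A = B := by
    intro A B h
    refine Matrix.toLin'.injective (LinearMap.ext_on_range (span_schurAmp n) fun l => ?_)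
    rw [toLin'_apply, toLin'_apply]; exact h l
  refine hspan _ _ fun l => ?_
  rw [submatrix_perm_mulVec, theta_mulVec_of_spinSq l.spinSq_mulVec_amp,
    theta_mulVec_of_spinSq (d := l.total)]
  · ext x; simp
  · have h := l.spinSq_mulVec_amp
    rw [← spinSq_univ_submatrix e, submatrix_perm_mulVec] at h
    ext x
    have := congrFun h ((permBasis e).symm x)
    simpa using this

theorem permBasis_swap_symm {n : ℕ} (i j : Fin n) :
    (permBasis (Equiv.swap i j)).symm = permBasis (Equiv.swap i j) := by
  ext x k
  change ((x ((Equiv.swap i j).symm k) : Fin 2) : ℕ) = x (Equiv.swap i j k)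
  rw [Equiv.symm_swap]

theorem swapOp_mulVec {n : ℕ} (i j : Fin n) (v : (Fin n → Fin 2) → ℂ) :
    swapOp i j *ᵥ v = v ∘ permBasis (Equiv.swap i j) := by
  ext x
  simp only [mulVec, dotProduct, swapOp, ← permBasis_apply]
  rw [Finset.sum_eq_single (permBasis (Equiv.swap i j) x)]
  · simp [permBasis_apply, Function.comp_assoc, ← Equiv.coe_trans]
  · intro y _ hy
    rw [if_neg, zero_mul]
    rintro rfl
    apply hy
    ext k; simp [permBasis_apply]
  · simp

theorem swapOp_mul_mul_swapOp {n : ℕ} (i j : Fin n) (A : Op n) :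
    swapOp i j * A * swapOp i j =
      A.submatrix (permBasis (Equiv.swap i j)) (permBasis (Equiv.swap i j)) := by
  refine Matrix.toLin'.injective (LinearMap.ext fun v => ?_)
  rw [toLin'_apply, toLin'_apply, ← mulVec_mulVec, ← mulVec_mulVec, swapOp_mulVec, swapOp_mulVec,
    submatrix_perm_mulVec, permBasis_swap_symm]

theorem swapOp_mul_self {n : ℕ} (i j : Fin n) : swapOp i j * swapOp i j = 1 := by
  have := swapOp_mul_mul_swapOp i j (1 : Op n)
  rwa [mul_one, submatrix_one_equiv] at this

/-- The swap lists the remaining ports in another order than `Fin.succAbove` does. The two orders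
differ by a permutation of `n` ports, which `theta_submatrix` absorbs. -/
theorem povm_eq_submatrix {n : ℕ} (i : Fin (n + 1)) :
    povm i = (povm (Fin.last n)).submatrix
      (permBasis (Equiv.swap i.castSucc (Fin.last n).castSucc))
      (permBasis (Equiv.swap i.castSucc (Fin.last n).castSucc)) := by
  set σ := Equiv.swap i (Fin.last n)
  have hσ : ∀ k : Fin (n + 1), Equiv.swap i.castSucc (Fin.last n).castSucc k.castSucc =
      (σ k).castSucc := fun k => ((Fin.castSucc_injective _).map_swap _ _ _).symm
  have hlast : Equiv.swap i.castSucc (Fin.last n).castSucc (Fin.last (n + 1)) =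
      Fin.last (n + 1) :=
    Equiv.swap_apply_of_ne_of_ne (Fin.castSucc_lt_last _).ne' (Fin.castSucc_lt_last _).ne'
  have hex : ∀ l : Fin n, ∃ k : Fin n, i.succAbove k = σ l.castSucc := by
    intro l
    refine Fin.exists_succAbove_eq fun h => ?_
    have : l.castSucc = Fin.last n :=
      σ.injective (h.trans (Equiv.swap_apply_right i (Fin.last n)).symm)
    exact (Fin.castSucc_lt_last l).ne this
  choose g hg using hex
  have hinj : Function.Injective g := by
    intro a b hab
    have : σ a.castSucc = σ b.castSucc := by rw [← hg, ← hg, hab]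
    exact Fin.castSucc_injective _ (σ.injective this)
  set e : Equiv.Perm (Fin n) := Equiv.ofBijective g (Finite.injective_iff_bijective.1 hinj)
  ext x y
  have hcomp : ∀ w : Fin (n + 2) → Fin 2, (fun l => w (i.succAbove l).castSucc) ∘ e =
      fun l => w (σ l.castSucc).castSucc := by
    intro w; funext l; simp [e, hg]
  have ht := congrFun (congrFun (theta_submatrix e) fun l => x (i.succAbove l).castSucc)
    fun l => y (i.succAbove l).castSucc
  rw [submatrix_apply, permBasis_apply, permBasis_apply, hcomp, hcomp] at ht
  simp only [submatrix_apply, povm, permBasis_apply, Function.comp_apply, hlast, hσ,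
    Fin.succAbove_last]
  rw [← ht, show σ (Fin.last n) = i from Equiv.swap_apply_right _ _]

theorem povm_eq_swapOp {n : ℕ} (i : Fin (n + 1)) :
    povm i = swapOp i.castSucc (Fin.last n).castSucc * povm (Fin.last n) *
      swapOp i.castSucc (Fin.last n).castSucc := by
  rw [swapOp_mul_mul_swapOp, povm_eq_submatrix]

theorem hasEigenvector_swapOp {n : ℕ} (i : Fin (n + 1)) {μ : ℂ} {v : Qubits (n + 2)}
    (h : Module.End.HasEigenvector (povm (Fin.last n)).toEnd μ v) :
    Module.End.HasEigenvector (povm i).toEnd μ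
      ((swapOp i.castSucc (Fin.last n).castSucc).toEnd v) := by
  have hv : v = WithLp.toLp 2 (WithLp.ofLp v) := rfl
  rw [hv, hasEigenvector_iff] at h
  rw [hv, Op.toEnd, Matrix.toLpLin_toLp, toLin'_apply, hasEigenvector_iff]
  obtain ⟨h1, h2⟩ := h
  refine ⟨?_, fun h0 => h2 ?_⟩
  · rw [povm_eq_swapOp, mulVec_mulVec, mul_assoc, swapOp_mul_self, mul_one, ← mulVec_mulVec, h1,
      mulVec_smul]
  · have := congrArg (swapOp i.castSucc (Fin.last n).castSucc *ᵥ ·) h0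
    simpa [mulVec_mulVec, swapOp_mul_self] using this

/-! ### The failure element -/

/-- The hypothesis is tracelessness: A ⊗ 1 + 1 ⊗ A multiplies the singlet by tr A. -/
theorem collective_mulVec_singletExt {n : ℕ} {A : Matrix (Fin 2) (Fin 2) ℂ}
    (hA : A 1 1 = -A 0 0) (w : (Fin n → Fin 2) → ℂ) :
    collective (n + 2) A *ᵥ singletExt w = singletExt (collective n A *ᵥ w) := by
  have h00 : singlet 0 0 = 0 := by simp [singlet]
  have h11 : singlet 1 1 = 0 := by simp [singlet]
  have h10 : singlet 1 0 = -singlet 0 1 := by simp [singlet]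
  simp only [singletExt_eq, Fin.sum_univ_two, mulVec_add, mulVec_smul,
    collective_mulVec_snocQubit, map_add, map_smul, h00, h11, h10, hA]
  module

theorem spinSq_mulVec_singletExt {n : ℕ} (w : (Fin n → Fin 2) → ℂ) :
    spinSq Finset.univ *ᵥ singletExt w = singletExt (spinSq Finset.univ *ᵥ w) := by
  simp only [spinSq, sum_mulVec, map_sum, ← mulVec_mulVec, angMom_univ]
  refine Finset.sum_congr rfl fun c _ => ?_
  have h : ((1 / 2 : ℂ) • pauli c) 1 1 = -((1 / 2 : ℂ) • pauli c) 0 0 := by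
    fin_cases c <;> simp [pauli]
  rw [collective_mulVec_singletExt h, collective_mulVec_singletExt h]

/-- This is the adjoint of `spinSq_mulVec_singletExt`, tested against Schur states. -/
theorem spinSq_mulVec_singletContract {n d : ℕ} {v : (Fin (n + 2) → Fin 2) → ℂ}
    (h : spinSq Finset.univ *ᵥ v = casimir d • v) :
    spinSq Finset.univ *ᵥ singletContract v = casimir d • singletContract v := by
  refine ext_of_schur fun l => ?_
  rw [star_dotProduct_mulVec_of_isHermitian (spinSq_isHermitian _), dotProduct_smul,
    ← star_singletExt_dotProduct, ← star_singletExt_dotProduct, ← spinSq_mulVec_singletExt,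
    ← star_dotProduct_mulVec_of_isHermitian (spinSq_isHermitian _), h, dotProduct_smul]

/-- The operator `1/4 - S^{(i)} · S^{(j)}`, which for `i ≠ j` is the projector onto the singlet of
the qubits `i` and `j`. -/
def singletProj {n : ℕ} (i j : Fin n) : Op n :=
  (1 / 4 : ℂ) • 1 - ∑ c, ((1 / 2 : ℂ) • onQubit (pauli c) i) * ((1 / 2 : ℂ) • onQubit (pauli c) j)

theorem singletProj_submatrix {n : ℕ} (i j : Fin n) (e : Equiv.Perm (Fin n)) :
    (singletProj i j).submatrix (permBasis e) (permBasis e) = singletProj (e i) (e j) := by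
  have hs : ∀ A B : Op n, (A + B).submatrix (permBasis e) (permBasis e) =
    A.submatrix (permBasis e) (permBasis e) + B.submatrix (permBasis e) (permBasis e) :=
    fun _ _ => rfl
  have hd : ∀ A B : Op n, (A - B).submatrix (permBasis e) (permBasis e) =
    A.submatrix (permBasis e) (permBasis e) - B.submatrix (permBasis e) (permBasis e) :=
    fun _ _ => rfl
  have hm : ∀ (a : ℂ) (A : Op n), (a • A).submatrix (permBasis e) (permBasis e) =
    a • A.submatrix (permBasis e) (permBasis e) := fun _ _ => rfl
  simp only [singletProj, Fin.sum_univ_three, hs, hd, hm,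
    ← submatrix_mul_equiv _ _ _ (permBasis e) _, onQubit_submatrix, submatrix_one_equiv]

theorem onQubit_mul_onQubit_mulVec {n : ℕ} (A B : Matrix (Fin 2) (Fin 2) ℂ) {i j : Fin n}
    (hij : i ≠ j) (v : (Fin n → Fin 2) → ℂ) (x : Fin n → Fin 2) :
    ((onQubit A i * onQubit B j) *ᵥ v) x = ∑ b, ∑ c, A (x i) b * B (x j) c *
      v (Function.update (Function.update x i b) j c) := by
  rw [← mulVec_mulVec, onQubit_mulVec]
  simp only [onQubit_mulVec, Function.update_of_ne hij.symm, Finset.mul_sum, mul_assoc]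

theorem singletExt_singletContract {n : ℕ} (v : (Fin (n + 2) → Fin 2) → ℂ) :
    singletExt (singletContract v) =
      singletProj (Fin.last n).castSucc (Fin.last (n + 1)) *ᵥ v := by
  ext x
  obtain ⟨y, a', rfl⟩ : ∃ y a', x = Fin.snoc (α := fun _ => Fin 2) y a' :=
    ⟨_, _, (Fin.snoc_init_self x).symm⟩
  obtain ⟨w, a, rfl⟩ : ∃ w a, y = Fin.snoc (α := fun _ => Fin 2) w a :=
    ⟨_, _, (Fin.snoc_init_self y).symm⟩
  have h2 : ((√2 : ℝ) : ℂ) * ((√2 : ℝ) : ℂ) = 2 := by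
    rw [← Complex.ofReal_mul, Real.mul_self_sqrt (by norm_num)]; simp
  have h3 : ((√2 : ℝ) : ℂ)⁻¹ * ((√2 : ℝ) : ℂ)⁻¹ = 1 / 2 := by
    rw [← mul_inv, h2]; norm_num
  have hne : (Fin.last n).castSucc ≠ Fin.last (n + 1) := (Fin.castSucc_lt_last _).ne
  rw [singletExt_apply]
  simp only [singletProj, Fin.sum_univ_three, sub_mulVec, add_mulVec, smul_mul_smul_comm,
    smul_mulVec, one_mulVec, Pi.sub_apply, Pi.add_apply, Pi.smul_apply,
    onQubit_mul_onQubit_mulVec _ _ hne]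
  simp only [← Fin.snoc_update, Fin.update_snoc_last, Fin.snoc_last, Fin.snoc_castSucc,
    singletContract, Fin.sum_univ_two]
  fin_cases a <;> fin_cases a' <;> simp [singlet, pauli] <;> grind

/-- Contraction with the singlet keeps the spin, so Θ̃ acts as the scalar σ(s) and only the singlet
projector remains. The case of port `i` is reduced to the last port by a swap, which does not change
the spin of `v`. -/
theorem povm_mulVec_of_spinSq {n d : ℕ} (i : Fin (n + 1)) {v : (Fin (n + 2) → Fin 2) → ℂ}
    (h : spinSq Finset.univ *ᵥ v = casimir d • v) :
    povm i *ᵥ v = sigmaVal n d • (singletProj i.castSucc (Fin.last (n + 1)) *ᵥ v) := by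
  set e := Equiv.swap i.castSucc (Fin.last n).castSucc
  have h1 : e (Fin.last n).castSucc = i.castSucc := Equiv.swap_apply_right _ _
  have h2 : e (Fin.last (n + 1)) = Fin.last (n + 1) :=
    Equiv.swap_apply_of_ne_of_ne (Fin.castSucc_lt_last _).ne' (Fin.castSucc_lt_last _).ne'
  have hv : spinSq Finset.univ *ᵥ (v ∘ (permBasis e).symm) =
      casimir d • (v ∘ (permBasis e).symm) := by
    rw [← spinSq_univ_submatrix e, submatrix_perm_mulVec] at h
    ext x
    have := congrFun h ((permBasis e).symm x)
    simpa using this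
  have hQ : singletProj i.castSucc (Fin.last (n + 1)) =
      (singletProj (Fin.last n).castSucc (Fin.last (n + 1))).submatrix
        (permBasis e) (permBasis e) := by rw [singletProj_submatrix, h1, h2]
  rw [hQ, povm_eq_submatrix, submatrix_perm_mulVec, submatrix_perm_mulVec, povm_last_mulVec,
    theta_mulVec_of_spinSq (spinSq_mulVec_singletContract hv), map_smul,
    singletExt_singletContract]
  rfl

theorem onQubit_mul_onQubit_comm {n : ℕ} (A B : Matrix (Fin 2) (Fin 2) ℂ) {i j : Fin n}
    (hij : i ≠ j) : onQubit A i * onQubit B j = onQubit B j * onQubit A i := by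
  refine Matrix.toLin'.injective (LinearMap.ext fun v => ?_)
  ext x
  rw [toLin'_apply, toLin'_apply, onQubit_mul_onQubit_mulVec _ _ hij,
    onQubit_mul_onQubit_mulVec _ _ hij.symm, Finset.sum_comm]
  refine Finset.sum_congr rfl fun b _ => Finset.sum_congr rfl fun c _ => ?_
  rw [Function.update_comm hij, mul_comm (A _ _)]

theorem onQubit_pauli_mul_self {n : ℕ} (c : Fin 3) (i : Fin n) :
    onQubit (pauli c) i * onQubit (pauli c) i = 1 := by
  refine Matrix.toLin'.injective (LinearMap.ext fun v => ?_)
  ext x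
  rw [toLin'_apply, toLin'_apply, ← mulVec_mulVec, onQubit_mulVec, one_mulVec]
  simp only [onQubit_mulVec, Function.update_idem, Function.update_self]
  have hx : v x = v (Function.update x i (x i)) := by rw [Function.update_eq_self]
  rw [hx]
  generalize x i = a
  fin_cases c <;> fin_cases a <;> simp [pauli, ← mul_assoc]

/-- The sum of the singlet projectors in terms of the spins of all the qubits and of the ports. -/
theorem sum_singletProj (n : ℕ) :
    ∑ i : Fin (n + 1), singletProj i.castSucc (Fin.last (n + 1)) =
      (((n : ℂ) + 1) / 4 + 3 / 8) • 1 -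
        (1 / 2 : ℂ) • (spinSq Finset.univ - spinSq (firstQubits (n + 2) (n + 1))) := by
  have hA : ∀ c, angMom (firstQubits (n + 2) (n + 1)) c =
      ∑ i : Fin (n + 1), (1 / 2 : ℂ) • onQubit (pauli c) i.castSucc := by
    intro c
    rw [angMom, firstQubits, Finset.sum_filter, Fin.sum_univ_castSucc,
      if_neg (by simp), add_zero]
    exact Finset.sum_congr rfl fun i _ => if_pos i.2
  -- Each component of the last spin squares to 1/4; the three together give the 3/4 that becomes
  -- 3/8 after halving.
  have hsq : ∀ c, angMom (Finset.univ : Finset (Fin (n + 2))) c * angMom Finset.univ c =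
      angMom (firstQubits (n + 2) (n + 1)) c * angMom (firstQubits (n + 2) (n + 1)) c +
        (2 : ℂ) • (angMom (firstQubits (n + 2) (n + 1)) c *
          ((1 / 2 : ℂ) • onQubit (pauli c) (Fin.last (n + 1)))) + (1 / 4 : ℂ) • 1 := by
    intro c
    have hu : angMom (Finset.univ : Finset (Fin (n + 2))) c =
        angMom (firstQubits (n + 2) (n + 1)) c +
          (1 / 2 : ℂ) • onQubit (pauli c) (Fin.last (n + 1)) := by
      rw [hA, angMom, Fin.sum_univ_castSucc]
    have hc : ((1 / 2 : ℂ) • onQubit (pauli c) (Fin.last (n + 1))) *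
        angMom (firstQubits (n + 2) (n + 1)) c = angMom (firstQubits (n + 2) (n + 1)) c *
        ((1 / 2 : ℂ) • onQubit (pauli c) (Fin.last (n + 1))) := by
      rw [hA, Finset.sum_mul, Finset.mul_sum]
      refine Finset.sum_congr rfl fun i _ => ?_
      rw [smul_mul_smul_comm, smul_mul_smul_comm,
        onQubit_mul_onQubit_comm _ _ (Fin.castSucc_lt_last i).ne]
    rw [hu, add_mul, mul_add, mul_add, hc, smul_mul_smul_comm (1 / 2 : ℂ) _ (1 / 2 : ℂ),
      onQubit_pauli_mul_self]
    module
  have hsum : ∑ i : Fin (n + 1), singletProj i.castSucc (Fin.last (n + 1)) =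
      (((n : ℂ) + 1) / 4) • 1 - ∑ c, angMom (firstQubits (n + 2) (n + 1)) c *
          ((1 / 2 : ℂ) • onQubit (pauli c) (Fin.last (n + 1))) := by
    simp only [singletProj, Finset.sum_sub_distrib, hA, Finset.sum_mul]
    congr 1
    · rw [Finset.sum_const, Finset.card_univ, Fintype.card_fin, ← Nat.cast_smul_eq_nsmul ℂ,
        smul_smul]
      congr 1; push_cast; ring
    · exact Finset.sum_comm
  rw [hsum]
  simp only [spinSq, Fin.sum_univ_three, hsq]
  module

theorem povmFail_mulVec_amp {n : ℕ} (l : SchurLabel (n + 2)) :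
    povmFail n *ᵥ l.amp = (1 - sigmaVal n l.total * (((n : ℂ) + 1) / 4 + 3 / 8 -
      1 / 2 * (casimir l.total - casimir (l.spin (Fin.last (n + 1)).castSucc)))) • l.amp := by
  have h1 : spinSq (firstQubits (n + 2) (n + 1)) *ᵥ l.amp =
      casimir (l.spin (Fin.last (n + 1)).castSucc) • l.amp :=
    spinSq_firstQubits_mulVec_schurAmp l.isSpinPath l.zspin (Fin.last (n + 1)).castSucc
  simp only [povmFail, sub_mulVec, one_mulVec, sum_mulVec,
    povm_mulVec_of_spinSq _ l.spinSq_mulVec_amp]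
  rw [← Finset.smul_sum, ← sum_mulVec, sum_singletProj, sub_mulVec, smul_mulVec, smul_mulVec,
    sub_mulVec, h1, l.spinSq_mulVec_amp, one_mulVec]
  module

end

end PBT

theorem mainTheorem2 (n N : ℕ) (hN : N = n + 1) :
    -- the Schur states of the `N + 1 = n + 2` qubits are an orthonormal basis of simultaneous
    -- eigenvectors of the spin operators of the initial segments and of `Z`
    (Orthonormal ℂ (PBT.SchurLabel.state : PBT.SchurLabel (n + 2) → PBT.Qubits (n + 2)) ∧
      Submodule.span ℂ (Set.range
        (PBT.SchurLabel.state : PBT.SchurLabel (n + 2) → PBT.Qubits (n + 2))) = ⊤ ∧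
      (∀ l : PBT.SchurLabel (n + 2),
        (∀ r : Fin (n + 3), Module.End.HasEigenvector
          (PBT.spinSq (Finset.univ.filter fun i : Fin (n + 2) => (i : ℕ) < (r : ℕ))).toEnd
          (PBT.casimir (l.spin r)) l.state) ∧
        Module.End.HasEigenvector
          (PBT.spinZ (Finset.univ : Finset (Fin (n + 2)))).toEnd ((l.zspin : ℂ) / 2) l.state)) ∧
    -- `Π_N`: the eigenvalue `σ(s) = 4 / (N + 3 + 2 s)`
    (∀ l : PBT.SchurLabel n, Module.End.HasEigenvector (PBT.povm (Fin.last n)).toEnd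
      (4 / ((N : ℂ) + 3 + 2 * ((l.total : ℂ) / 2))) l.sigmaVec) ∧
    -- `Π_N`: the eigenvalue `0`
    (∀ l : PBT.SchurLabel (n + 2),
      l.spin (Fin.last n).castSucc.castSucc ≠ l.total →
      Module.End.HasEigenvector (PBT.povm (Fin.last n)).toEnd 0 l.state) ∧
    (∀ l : PBT.SchurLabel n, l.total ≠ 0 →
      Module.End.HasEigenvector (PBT.povm (Fin.last n)).toEnd 0 l.nullVec) ∧
    (∀ v : PBT.Qubits (n + 2), (∀ l : PBT.SchurLabel n, inner ℂ l.sigmaVec v = 0) →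
      (PBT.povm (Fin.last n)).toEnd v = 0) ∧
    -- `Π_i = SWAP_{A_i A_N} Π_N SWAP_{A_i A_N}`, so that `SWAP` carries eigenvectors to eigenvectors
    (∀ i : Fin (n + 1),
      PBT.povm i = PBT.swapOp i.castSucc (Fin.last n).castSucc * PBT.povm (Fin.last n) *
        PBT.swapOp i.castSucc (Fin.last n).castSucc ∧
      ∀ (μ : ℂ) (v : PBT.Qubits (n + 2)),
        Module.End.HasEigenvector (PBT.povm (Fin.last n)).toEnd μ v →
        Module.End.HasEigenvector (PBT.povm i).toEnd μ
          ((PBT.swapOp i.castSucc (Fin.last n).castSucc).toEnd v)) ∧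
    -- `Π_{N+1}` on the Schur basis
    (∀ l : PBT.SchurLabel (n + 2),
      (l.total = l.spin (Fin.last (n + 1)).castSucc + 1 →
        Module.End.HasEigenvector (PBT.povmFail n).toEnd
          (2 * (2 * ((l.total : ℂ) / 2) + 1) / ((N : ℂ) + 3 + 2 * ((l.total : ℂ) / 2)))
          l.state) ∧
      (l.total + 1 = l.spin (Fin.last (n + 1)).castSucc →
        Module.End.HasEigenvector (PBT.povmFail n).toEnd 0 l.state)) := by
  subst hN
  have hden : ∀ d : ℕ, ((n + 1 : ℕ) : ℂ) + 3 + 2 * ((d : ℂ) / 2) = (n : ℂ) + 1 + 3 + d := by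
    intro d; push_cast; ring
  have hne : ∀ d : ℕ, (n : ℂ) + 1 + 3 + d ≠ 0 := by
    intro d
    have : ((n + 1 + 3 + d : ℕ) : ℂ) ≠ 0 := Nat.cast_ne_zero.2 (by omega)
    push_cast at this
    exact this
  refine ⟨⟨PBT.SchurLabel.orthonormal_state _, PBT.SchurLabel.span_state _,
      fun l => ⟨fun r => ?_, ?_⟩⟩,
    fun l => ?_, fun l hl => ?_, fun l hl => ?_, fun v hv => ?_, fun i => ⟨PBT.povm_eq_swapOp i,
      fun μ v hv => PBT.hasEigenvector_swapOp i hv⟩, fun l => ⟨fun hl => ?_, fun hl => ?_⟩⟩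
  · exact (PBT.hasEigenvector_iff _ _ l.amp).2
      ⟨PBT.spinSq_firstQubits_mulVec_schurAmp l.isSpinPath l.zspin r, l.amp_ne_zero⟩
  · exact (PBT.hasEigenvector_iff _ _ l.amp).2
      ⟨PBT.spinZ_mulVec_schurAmp l.spin l.zspin, l.amp_ne_zero⟩
  · rw [hden]; exact l.hasEigenvector_sigmaVec
  · exact PBT.hasEigenvector_povm_last_zero
      ((PBT.SchurLabel.orthonormal_state _).ne_zero l) fun l' => l'.inner_sigmaVec_state hl
  · exact PBT.hasEigenvector_povm_last_zero (l.nullVec_ne_zero hl)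
      fun l' => l'.inner_sigmaVec_nullVec l hl
  · exact congrArg (WithLp.toLp 2) (PBT.povm_last_mulVec_eq_zero (v := WithLp.ofLp v) hv)
  -- For s = j + ½ the Casimir difference is s + 1/4, so the singlet projectors sum to (N + 1 -
  -- 2s)/4.
  · refine (PBT.hasEigenvector_iff _ _ l.amp).2 ⟨?_, l.amp_ne_zero⟩
    rw [PBT.povmFail_mulVec_amp, hden, PBT.sigmaVal, PBT.casimir, PBT.casimir]
    congr 1
    have h := hne l.total
    rw [hl] at h ⊢
    push_cast at h ⊢
    field_simp
    ring
  -- For s = j - ½ the Casimir difference is -s - 3/4, so the sum is (N + 3 + 2s)/4 = 1/σ(s), and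
  -- the eigenvalue is 1 - 1.
  · refine (PBT.hasEigenvector_iff _ _ l.amp).2 ⟨?_, l.amp_ne_zero⟩
    rw [PBT.povmFail_mulVec_amp, PBT.sigmaVal, PBT.casimir, PBT.casimir, ← hl]
    congr 1
    have h := hne l.total
    push_cast
    field_simp
    ring
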